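/- Let $m$ be Lebesgue measure on $[0,1]$; functions are real-valued, measurable, and identified when equal a.e. A Banach function space $X$ on $[0,1]$ is a linear space of measurable functions with a complete norm such that $g\in X$ and $|f|\le |g|$ a.e. imply $f\in X$ and $\|f\|_X\le\|g\|_X$. It is rearrangement invariant (r.i.) if $f\in X$ and $m(\{|f|>s\})=m(\{|g|>s\})$ for all $s>0$ imply $g\in X$ and $\|g\|_X=\|f\|_X$. Let $M_2(t)=e^{t^2}-1$, let $L^{M_2}$ be the Orlicz space of all $f$ for which $\|f\|_{L^{M_2}}=\inf\{\lambda>0:\int_0^1 M_2(|f|/\lambda)\,dm\le 1\}$ is finite, and let $G$ be the closure of $L^\infty$ in $L^{M_2}$. Let $r_k(t)=\operatorname{sign}\sin(2^k\pi t)$, $k\ge1$, and let $w_n=\prod_{i\ge 0} r_{i+1}^{\varepsilon_i}$ for $n=\sum_{i\ge0}\varepsilon_i2^i$, $\varepsilon_i\in\{0,1\}$, be the Walsh functions in Paley's numbering. For $q>1$, a sequence $(w_{n_k})_{k\ge1}$ with integers $n_k\ge 1$ is called $q$-lacunary if $n_{k+1}/n_k\ge q$ for all $k\ge1$. For a measurable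 set $E\subset[0,1]$ with $m(E)>0$, let $\rho_E(x)=m(E\cap[0,x])/m(E)$, let $\rho_E^{-1}(t)=\inf\{x\in[0,1]:\rho_E(x)\ge t\}$, and let $X|E$ be the space of measurable functions $f$ on $E$ for which $\|f\|_{X|E}=\|f\circ\rho_E^{-1}\|_X$ is finite. **Theorem.** Let $q>1$. To every measurable set $E\subset[0,1]$ of positive measure one can assign an $N=N(E,q)\in\mathbb N$ such that the following holds. For every r.i. space $X$ on $[0,1]$ with $G\subset X$ there are constants $A'(X,q),B'(X,q)>0$, depending only on $X$ and $q$, such that for every measurable set $E\subset[0,1]$ of positive measure, every $q$-lacunary sequence $(w_{n_k})$ of Walsh functions with $n_k\ge N(E,q)$ for all $k\ge1$, and every real sequence $(a_k)_{k\ge1}\in\ell^2$, the series $\sum_{k\ge1}a_kw_{n_k}$ converges in $L^2([0,1])$, the restriction of its sum to $E$ belongs to $X|E$, and $$A'(X,q)\Big(\sum_{k=1}^\infty a_k^2\Big)^{1/2}\le\Big\|\sum_{k\ge1}a_kw_{n_k}\Big\|_{X|E}\le B'(X,q)\Big(\sum_{k=1}^\infty a_k^2\Big)^{1/2}.$$ 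-/

import Mathlib

open MeasureTheory Set Filter Topology
open scoped unitInterval ENNReal

noncomputable section

namespace LacunaryWalsh

/-- Real measurable functions on `[0,1]` (with Lebesgue measure), modulo equality a.e. -/
abbrev L0 : Type := I →ₘ[(volume : Measure I)] ℝ

/-! ### Banach function spaces and rearrangement invariant spaces -/

/-- A Banach function space `X` on `[0,1]`. It is given by its extended norm `‖·‖_X` on the measurable
functions, with value `∞` exactly at the functions outside `X`; see `BanachFunctionSpace.carrier`
for the linear subspace `X` itself. -/
structure BanachFunctionSpace where
  extNorm : L0 → ℝ≥0∞
  extNorm_smul : ∀ (c : ℝ) (f : L0), extNorm (c • f) = ENNReal.ofReal |c| * extNorm f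
  extNorm_add_le : ∀ f g : L0, extNorm (f + g) ≤ extNorm f + extNorm g
  eq_zero_of_extNorm_eq_zero : ∀ f : L0, extNorm f = 0 → f = 0
  /-- The lattice (ideal) property. If `g ∈ X`, this gives `f ∈ X` and `‖f‖_X ≤ ‖g‖_X`. -/
  extNorm_mono : ∀ f g : L0, (∀ᵐ t, |f t| ≤ |g t|) → extNorm f ≤ extNorm g
  /-- Completeness: Cauchy sequences in `X` converge in `X`. -/
  complete : ∀ f : ℕ → L0, (∀ k, extNorm (f k) < ∞) →
    (∀ ε : ℝ≥0∞, 0 < ε → ∃ K, ∀ j ≥ K, ∀ k ≥ K, extNorm (f j - f k) ≤ ε) →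
    ∃ g : L0, extNorm g < ∞ ∧ Tendsto (fun k => extNorm (f k - g)) atTop (𝓝 0)

/-- The linear space `X` underlying a Banach function space. -/
def BanachFunctionSpace.carrier (X : BanachFunctionSpace) : Submodule ℝ L0 where
  carrier := {f | X.extNorm f < ∞}
  zero_mem' := by
    have h := X.extNorm_smul 0 0
    simp only [zero_smul, abs_zero, ENNReal.ofReal_zero, zero_mul] at h
    simp [h]
  add_mem' := fun {f g} hf hg =>
    lt_of_le_of_lt (X.extNorm_add_le f g) (ENNReal.add_lt_top.2 ⟨hf, hg⟩)
  smul_mem' := fun c f hf => by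
    change X.extNorm (c • f) < ∞
    rw [X.extNorm_smul]
    exact ENNReal.mul_lt_top ENNReal.ofReal_lt_top hf

/-- The distribution function `m_f(s) = m({t : |f(t)| > s})`. -/
def distribution (f : L0) (s : ℝ) : ℝ≥0∞ := volume {t : I | s < |f t|}

/-- `X` is rearrangement invariant: if `m_f = m_g` and `f ∈ X`, then `g ∈ X` and
`‖g‖_X = ‖f‖_X`. -/
def BanachFunctionSpace.IsRearrangementInvariant (X : BanachFunctionSpace) : Prop :=
  ∀ f g : L0, (∀ s : ℝ, 0 < s → distribution f s = distribution g s) → f ∈ X.carrier →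
    g ∈ X.carrier ∧ X.extNorm g = X.extNorm f

/-! ### The Orlicz space generated by `exp(t²) - 1` and the space `G` -/

/-- The (Luxemburg) norm of the Orlicz space generated by `Φ`; it is `∞` if no `c` is admissible. -/
def orliczNorm (Φ : ℝ → ℝ) (f : L0) : ℝ≥0∞ :=
  ⨅ (c : ℝ) (_ : 0 < c ∧ ∫⁻ t : I, ENNReal.ofReal (Φ (|f t| / c)) ≤ 1), ENNReal.ofReal c

/-- `M₂(t) = exp(t²) - 1`. -/
def M2 (t : ℝ) : ℝ := Real.exp (t ^ 2) - 1

/-- The space `G`: the closure of `L^∞` in the Orlicz space `L^{M₂}`. -/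
def spaceG : Set L0 :=
  {f | orliczNorm M2 f < ∞ ∧
    ∀ ε : ℝ≥0∞, 0 < ε → ∃ g : L0, g ∈ Lp ℝ ∞ (volume : Measure I) ∧ orliczNorm M2 (f - g) ≤ ε}

/-! ### The Walsh system in Paley's numbering -/

/-- The Rademacher functions `r_k(t) = sign sin(2^k π t)`, `k ≥ 1`. -/
def rademacher (k : ℕ) (t : I) : ℝ := Real.sign (Real.sin (2 ^ k * Real.pi * (t : ℝ)))

/-- The Walsh functions: `w_k = ∏ r_{i+1}` over the positions `i` of the binary digits `1` of `k`. -/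
def walsh (k : ℕ) (t : I) : ℝ :=
  ∏ i ∈ Finset.range k.size, if k.testBit i then rademacher (i + 1) t else 1

theorem measurable_rademacher (k : ℕ) : Measurable (rademacher k) := by
  have hs : Measurable Real.sign := by
    unfold Real.sign
    exact Measurable.ite measurableSet_Iio measurable_const
      (Measurable.ite measurableSet_Ioi measurable_const measurable_const)
  exact hs.comp (by fun_prop)

theorem abs_rademacher_le (k : ℕ) (t : I) : |rademacher k t| ≤ 1 := by
  unfold rademacher
  rcases Real.sign_apply_eq (Real.sin (2 ^ k * Real.pi * (t : ℝ))) with h | h | h <;> simp [h]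

theorem measurable_walsh (k : ℕ) : Measurable (walsh k) := by
  unfold walsh
  refine Finset.measurable_fun_prod _ fun i _ => ?_
  split_ifs
  · exact measurable_rademacher _
  · exact measurable_const

theorem abs_walsh_le (k : ℕ) (t : I) : |walsh k t| ≤ 1 := by
  unfold walsh
  rw [Finset.abs_prod]
  refine Finset.prod_le_one (fun _ _ => abs_nonneg _) fun i _ => ?_
  split_ifs
  · exact abs_rademacher_le _ _
  · simp

theorem memLp_walsh (k : ℕ) : MemLp (walsh k) 2 (volume : Measure I) :=
  MemLp.of_bound (measurable_walsh k).aestronglyMeasurable 1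
    (Eventually.of_forall fun t => abs_walsh_le k t)

/-- The Walsh function `w_k` as an element of `L²([0,1])`. -/
def walshL2 (k : ℕ) : Lp ℝ 2 (volume : Measure I) := (memLp_walsh k).toLp (walsh k)

/-- `(w_{n_k})` is `q`-lacunary: `n_{k+1} / n_k ≥ q` for all `k`, the `n_k` being positive. -/
def IsLacunary (q : ℝ) (n : ℕ → ℕ) : Prop :=
  ∀ k, 0 < n k ∧ q ≤ (n (k + 1) : ℝ) / (n k : ℝ)

/-! ### The local space `X|E` -/

/-- `ρ_E(x) = m(E ∩ [0,x]) / m(E)`. -/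
def rho (E : Set I) (x : I) : ℝ := volume.real (E ∩ Iic x) / volume.real E

/-- The left continuous inverse of `ρ_E`, namely `t ↦ inf {x ∈ [0,1] : ρ_E(x) ≥ t}`. -/
def rhoInv (E : Set I) (t : I) : I := sInf {x : I | (t : ℝ) ≤ rho E x}

theorem rho_mono (E : Set I) : Monotone (rho E) := fun x y h => by
  unfold rho
  gcongr
  exact measure_ne_top _ _

theorem rho_sub_le (E : Set I) {x y : I} (h : x ≤ y) :
    rho E y - rho E x ≤ ((y : ℝ) - x) / volume.real E := by
  unfold rho
  rw [← sub_div]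
  refine div_le_div_of_nonneg_right ?_ measureReal_nonneg
  have h1 : E ∩ Iic y ⊆ (E ∩ Iic x) ∪ Ioc x y := by
    rintro z ⟨hz, hzy⟩
    by_cases hzx : z ≤ x
    · exact Or.inl ⟨hz, hzx⟩
    · exact Or.inr ⟨not_le.1 hzx, hzy⟩
  have h2 := (measureReal_mono h1 (measure_ne_top volume _)).trans (measureReal_union_le _ _)
  have h3 : volume.real (Ioc x y) = (y : ℝ) - x := by
    rw [Measure.real, unitInterval.volume_Ioc, ENNReal.toReal_ofReal (sub_nonneg.2 h)]
  linarith

theorem rhoInv_le_iff {E : Set I} (hE : 0 < volume E) (t x : I) :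
    rhoInv E t ≤ x ↔ (t : ℝ) ≤ rho E x := by
  have hEr : 0 < volume.real E := ENNReal.toReal_pos hE.ne' (measure_ne_top _ _)
  constructor
  · intro h
    refine le_of_forall_pos_le_add fun ε hε => ?_
    have hmem : (1 : I) ∈ {x : I | (t : ℝ) ≤ rho E x} := by
      have : Iic (1 : I) = univ := eq_univ_of_forall fun z => z.2.2
      change (t : ℝ) ≤ rho E 1
      rw [rho, this, inter_univ, div_self hEr.ne']
      exact t.2.2
    by_cases hx1 : x = 1
    · subst hx1
      exact hmem.trans (by linarith)
    have hx1' : (x : ℝ) < 1 := lt_of_le_of_ne x.2.2 fun h => hx1 (Subtype.ext h)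
    let y : I := ⟨min 1 (x + ε * volume.real E),
      le_min zero_le_one (add_nonneg x.2.1 (by positivity)), min_le_left _ _⟩
    have hxy : x < y := by
      change (x : ℝ) < min 1 (x + ε * volume.real E)
      exact lt_min hx1' (by linarith [mul_pos hε hEr])
    obtain ⟨z, hz, hzy⟩ := (sInf_lt_iff (b := y)).1 (lt_of_le_of_lt h hxy)
    have h1 : rho E y - rho E x ≤ ε := by
      refine (rho_sub_le E hxy.le).trans ?_
      rw [div_le_iff₀ hEr]
      have : (y : ℝ) ≤ x + ε * volume.real E := min_le_right _ _
      linarith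
    have h2 : (t : ℝ) ≤ rho E y := le_trans hz (rho_mono E hzy.le)
    linarith
  · intro h
    exact sInf_le h

theorem measurable_rhoInv {E : Set I} (hE : 0 < volume E) : Measurable (rhoInv E) := by
  refine measurable_of_Iic fun x => ?_
  have : rhoInv E ⁻¹' Iic x = {t : I | (t : ℝ) ≤ rho E x} := by
    ext t
    exact rhoInv_le_iff hE t x
  rw [this]
  exact measurableSet_le measurable_subtype_coe measurable_const

/-- `ρ_E⁻¹` carries Lebesgue measure on `[0,1]` to the normalized Lebesgue measure on `E`. -/
theorem map_rhoInv {E : Set I} (hE : 0 < volume E) :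
    Measure.map (rhoInv E) (volume : Measure I) = (volume E)⁻¹ • volume.restrict E := by
  have hEr : 0 < volume.real E := ENNReal.toReal_pos hE.ne' (measure_ne_top _ _)
  have : IsProbabilityMeasure (Measure.map (rhoInv E) (volume : Measure I)) :=
    Measure.isProbabilityMeasure_map (measurable_rhoInv hE).aemeasurable
  refine Measure.ext_of_Iic _ _ fun x => ?_
  rw [Measure.map_apply (measurable_rhoInv hE) measurableSet_Iic, Measure.smul_apply,
    Measure.restrict_apply measurableSet_Iic, smul_eq_mul]
  have h0 : 0 ≤ rho E x := by unfold rho; positivity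
  have h1 : rho E x ≤ 1 := by
    unfold rho
    rw [div_le_one hEr]
    exact measureReal_mono inter_subset_left (measure_ne_top _ _)
  have hset : rhoInv E ⁻¹' Iic x = Iic (⟨rho E x, h0, h1⟩ : I) := by
    ext t
    exact rhoInv_le_iff hE t x
  rw [hset, unitInterval.volume_Iic]
  change ENNReal.ofReal (volume.real (E ∩ Iic x) / volume.real E) = _
  rw [ENNReal.ofReal_div_of_pos hEr, Measure.real, Measure.real,
    ENNReal.ofReal_toReal (measure_ne_top _ _), ENNReal.ofReal_toReal (measure_ne_top _ _),
    ENNReal.div_eq_inv_mul, inter_comm]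

theorem quasiMeasurePreserving_rhoInv {E : Set I} (hE : 0 < volume E) :
    Measure.QuasiMeasurePreserving (rhoInv E) (volume : Measure I) (volume.restrict E) :=
  ⟨measurable_rhoInv hE, by
    rw [map_rhoInv hE]
    exact Measure.smul_absolutelyContinuous⟩

/-- Real measurable functions on `E`, modulo equality a.e. on `E`. -/
abbrev L0On (E : Set I) : Type := I →ₘ[(volume : Measure I).restrict E] ℝ

/-- The restriction of a function on `[0,1]` to `E`. -/
def restrictTo (E : Set I) (f : L0) : L0On E := AEEqFun.mk f f.aestronglyMeasurable.restrict

/-- The norm of the local space `X|E`: `‖f‖_{X|E} = ‖f ∘ ρ_E⁻¹‖_X` for measurable `f` on `E`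
(`∞` if `f ∉ X|E`). -/
def BanachFunctionSpace.localNorm (X : BanachFunctionSpace) (E : Set I) (hE : 0 < volume E)
    (f : L0On E) : ℝ≥0∞ :=
  X.extNorm (f.compQuasiMeasurePreserving (rhoInv E) (quasiMeasurePreserving_rhoInv hE))

end LacunaryWalsh

end

/-!
Approximate `E` by a finite union `D` of dyadic intervals of length `2⁻ˡ`. Walsh functions whose
leading binary digits are distinct and exceed `l` form, on `D` as on `[0,1]`, an independent system
of signs. If `2 ≤ q ^ L`, a `q`-lacunary sequence splits into `L` classes with distinct leading
digits, so a sum `∑ a_k w_{n_k}` is subgaussian on `D` with variance proxy `L v`, where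
`v = ∑ a_k²`. Also `w_m w_n = w_{m xor n}`, and lacunarity makes all these xors large, so the cross
terms vanish on `D` and the mean of the square there is exactly `v`. By Cauchy–Schwarz, replacing
`D` by `E` costs little, and on `E` the mean of `exp (f² / (8 L v))` is at most `2` while that of
`f²` is at least `v / 2`.

The Paley–Zygmund inequality then gives `|f| > √v / 2` on a proportion of `E` that depends only on
`L`, and rearrangement invariance turns this into the lower bound. For the upper bound, `f ∘ ρ_E⁻¹`
lies in `G`, with norm at most `√(8 L v)`, and an inclusion `G ⊂ X` is automatically bounded.
-/

noncomputable section

open ProbabilityTheory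
open scoped NNReal symmDiff

namespace LacunaryWalsh

/-! ### Integral inequalities and subgaussian variables -/

section Integral

variable {Ω : Type*} [MeasurableSpace Ω] {μ : Measure Ω}

theorem abs_setIntegral_sub_setIntegral_le [IsFiniteMeasure μ] {A B : Set Ω}
    (hA : NullMeasurableSet A μ) (hB : NullMeasurableSet B μ) {h : Ω → ℝ} (hh : MemLp h 2 μ) :
    |∫ x in A, h x ∂μ - ∫ x in B, h x ∂μ| ≤ √(μ.real (A ∆ B)) * √(∫ x, h x ^ 2 ∂μ) := by
  obtain ⟨A', hA', hAA'⟩ := hA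
  obtain ⟨B', hB', hBB'⟩ := hB
  have hinner {C : Set Ω} (hC : MeasurableSet C) :
      ∫ x in C, h x ∂μ = inner ℝ (indicatorConstLp 2 hC (measure_ne_top μ C) (1 : ℝ))
        (hh.toLp h) := by
    rw [L2.inner_indicatorConstLp_one]
    exact setIntegral_congr_ae hC (hh.coeFn_toLp.mono fun x hx _ => hx.symm)
  have hnorm : ‖hh.toLp h‖ = √(∫ x, h x ^ 2 ∂μ) := by
    rw [← Real.sqrt_sq (norm_nonneg _), ← real_inner_self_eq_norm_sq, L2.inner_def]
    congr 1
    refine integral_congr_ae (hh.coeFn_toLp.mono fun x hx => ?_)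
    simp [hx, pow_two]
  rw [setIntegral_congr_set hAA', setIntegral_congr_set hBB',
    measureReal_congr (hAA'.symmDiff hBB'), hinner hA', hinner hB', ← inner_sub_left, ← hnorm]
  refine (abs_real_inner_le_norm _ _).trans_eq ?_
  rw [← dist_eq_norm, dist_indicatorConstLp_eq_norm, norm_indicatorConstLp (by simp) (by simp)]
  simp [Real.sqrt_eq_rpow]

theorem sq_integral_sub_le_measureReal_mul [IsProbabilityMeasure μ] {g : Ω → ℝ} {θ : ℝ}
    (hg : MemLp g 2 μ) (hθ0 : 0 ≤ θ) (hθ : θ ≤ ∫ x, g x ∂μ) :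
    (∫ x, g x ∂μ - θ) ^ 2 ≤ μ.real {x | θ < g x} * ∫ x, g x ^ 2 ∂μ := by
  have hA : NullMeasurableSet {x | θ < g x} μ :=
    nullMeasurableSet_lt aemeasurable_const hg.aestronglyMeasurable.aemeasurable
  have hint := hg.integrable one_le_two
  have hsplit : ∫ x, g x ∂μ - θ ≤ ∫ x in {x | θ < g x}, g x ∂μ := by
    have hcompl : ∫ x in {x | θ < g x}ᶜ, g x ∂μ ≤ θ :=
      calc ∫ x in {x | θ < g x}ᶜ, g x ∂μ ≤ ∫ _ in {x | θ < g x}ᶜ, θ ∂μ :=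
            setIntegral_mono_on₀ hint.integrableOn (integrable_const _) hA.compl
              fun x hx => not_lt.1 hx
        _ ≤ θ := by
            rw [setIntegral_const, smul_eq_mul]
            exact mul_le_of_le_one_left hθ0 measureReal_le_one
    linarith [integral_add_compl₀ hA hint]
  have hCS := abs_setIntegral_sub_setIntegral_le hA MeasurableSet.empty.nullMeasurableSet hg
  rw [setIntegral_empty, sub_zero, ← bot_eq_empty, symmDiff_bot,
    ← Real.sqrt_mul measureReal_nonneg] at hCS
  have hle := hsplit.trans ((le_abs_self _).trans hCS)
  exact (pow_le_pow_left₀ (sub_nonneg.2 hθ) hle 2).trans_eq (Real.sq_sqrt (by positivity))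

theorem exp_mul_sq_div_two_eq_integral_gaussianReal (s : ℝ≥0) (x : ℝ) :
    Real.exp (s * x ^ 2 / 2) = ∫ y, Real.exp (x * y) ∂gaussianReal 0 s := by
  have h := mgf_gaussianReal (p := gaussianReal 0 s) (X := id) (μ := 0) (v := s) (by simp) x
  simpa only [mgf, id, zero_mul, zero_add] using h.symm

theorem lintegral_exp_mul_sq_div_two_gaussianReal {v s : ℝ≥0} (hvs : v * s < 1) :
    ∫⁻ y, ENNReal.ofReal (Real.exp (v * y ^ 2 / 2)) ∂gaussianReal 0 s =
      ENNReal.ofReal (1 / √(1 - v * s)) := by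
  have hvs' : (v * s : ℝ) < 1 := by exact_mod_cast hvs
  rcases eq_or_ne s 0 with rfl | hs
  · simp
  have hb : 0 < (1 - v * s) / (2 * s : ℝ) :=
    div_pos (sub_pos.2 hvs') (by have := pos_iff_ne_zero.2 hs; positivity)
  have hdens (y : ℝ) : gaussianPDF 0 s y * ENNReal.ofReal (Real.exp (v * y ^ 2 / 2)) =
      ENNReal.ofReal ((√(2 * Real.pi * s))⁻¹ * Real.exp (-((1 - v * s) / (2 * s)) * y ^ 2)) := by
    rw [gaussianPDF, gaussianPDFReal, ← ENNReal.ofReal_mul (by positivity), mul_assoc,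
      ← Real.exp_add]
    congr 3
    field
  rw [gaussianReal_of_var_ne_zero _ hs,
    lintegral_withDensity_eq_lintegral_mul _ (measurable_gaussianPDF _ _) (by fun_prop)]
  simp_rw [Pi.mul_apply, hdens]
  rw [← ofReal_integral_eq_lintegral_ofReal ((integrable_exp_neg_mul_sq hb).const_mul _)
    (ae_of_all _ fun _ => by positivity), integral_const_mul, integral_gaussian]
  congr 1
  rw [← Real.sqrt_inv, ← Real.sqrt_mul (by positivity), one_div, ← Real.sqrt_inv]
  congr 1
  field

-- Gaussian linearisation: `exp (s X² / 2)` is the average of `exp (y X)` over `y ~ N(0, s)`.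
theorem lintegral_exp_mul_sq_le_of_hasSubgaussianMGF [SFinite μ] {X : Ω → ℝ} {v s : ℝ≥0}
    (hX : HasSubgaussianMGF X v μ) (hvs : v * s < 1) :
    ∫⁻ x, ENNReal.ofReal (Real.exp (s * X x ^ 2 / 2)) ∂μ ≤ ENNReal.ofReal (1 / √(1 - v * s)) := by
  have hmeas : AEMeasurable (fun p : Ω × ℝ => ENNReal.ofReal (Real.exp (p.2 * X p.1)))
      (μ.prod (gaussianReal 0 s)) :=
    (measurable_snd.aemeasurable.mul hX.aemeasurable.comp_fst).exp.ennreal_ofReal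
  have hgauss (x : Ω) : ENNReal.ofReal (Real.exp (s * X x ^ 2 / 2)) =
      ∫⁻ y, ENNReal.ofReal (Real.exp (y * X x)) ∂gaussianReal 0 s := by
    simp_rw [exp_mul_sq_div_two_eq_integral_gaussianReal, mul_comm _ (X x)]
    exact ofReal_integral_eq_lintegral_ofReal (integrable_exp_mul_gaussianReal (X x))
      (ae_of_all _ fun _ => (Real.exp_pos _).le)
  calc
    ∫⁻ x, ENNReal.ofReal (Real.exp (s * X x ^ 2 / 2)) ∂μ
      = ∫⁻ x, ∫⁻ y, ENNReal.ofReal (Real.exp (y * X x)) ∂gaussianReal 0 s ∂μ := by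
        simp_rw [hgauss]
    _ = ∫⁻ y, ∫⁻ x, ENNReal.ofReal (Real.exp (y * X x)) ∂μ ∂gaussianReal 0 s :=
        lintegral_lintegral_swap hmeas
    _ ≤ ∫⁻ y, ENNReal.ofReal (Real.exp (v * y ^ 2 / 2)) ∂gaussianReal 0 s := by
        refine lintegral_mono fun y => ?_
        rw [← ofReal_integral_eq_lintegral_ofReal (hX.integrable_exp_mul y)
          (ae_of_all _ fun _ => (Real.exp_pos _).le)]
        exact ENNReal.ofReal_le_ofReal (hX.mgf_le y)
    _ = _ := lintegral_exp_mul_sq_div_two_gaussianReal hvs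

theorem integral_exp_mul_sq_le_of_hasSubgaussianMGF [SFinite μ] {X : Ω → ℝ} {v : ℝ≥0} {s : ℝ}
    (hX : HasSubgaussianMGF X v μ) (hs : 0 ≤ s) (hvs : v * s ≤ 1 / 4) :
    ∫ x, Real.exp (s * X x ^ 2) ∂μ ≤ 3 / 2 := by
  lift s to ℝ≥0 using hs
  have hlt : v * (2 * s) < 1 := by
    rw [← NNReal.coe_lt_coe]
    push_cast
    linarith
  have h := lintegral_exp_mul_sq_le_of_hasSubgaussianMGF hX hlt
  push_cast at h
  have hsqrt : (2 : ℝ) / 3 ≤ √(1 - v * (2 * s)) := Real.le_sqrt_of_sq_le (by linarith)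
  rw [integral_eq_lintegral_of_nonneg_ae (ae_of_all _ fun _ => (Real.exp_pos _).le)
    (by have := hX.aestronglyMeasurable; fun_prop)]
  refine ENNReal.toReal_le_of_le_ofReal (by norm_num) ((lintegral_mono fun x => ?_).trans
    (h.trans (ENNReal.ofReal_le_ofReal ?_)))
  · exact ENNReal.ofReal_le_ofReal (Real.exp_le_exp.2 (by linarith))
  · rw [div_le_iff₀ (by linarith)]
    linarith

theorem memLp_two_sq_of_integrable_exp {X : Ω → ℝ} (hX : AEStronglyMeasurable X μ) {s : ℝ}
    (hs : 0 < s) (hint : Integrable (fun x => Real.exp (s * X x ^ 2)) μ) :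
    MemLp (fun x => X x ^ 2) 2 μ := by
  refine (memLp_two_iff_integrable_sq (hX.pow 2)).2
    ((hint.const_mul (2 / s ^ 2)).mono' ((hX.pow 2).pow 2) (ae_of_all _ fun x => ?_))
  have hx : 0 ≤ s * X x ^ 2 := by positivity
  rw [Real.norm_of_nonneg (by positivity), div_mul_eq_mul_div, le_div_iff₀ (by positivity),
    Pi.pow_apply]
  linarith [Real.quadratic_le_exp_of_nonneg hx]

theorem sq_mul_integral_pow_four_le [IsProbabilityMeasure μ] {X : Ω → ℝ} {s : ℝ} (hs : 0 ≤ s)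
    (hint : Integrable (fun x => Real.exp (s * X x ^ 2)) μ) :
    s ^ 2 * ∫ x, X x ^ 4 ∂μ ≤ 2 * (∫ x, Real.exp (s * X x ^ 2) ∂μ - 1) :=
  calc s ^ 2 * ∫ x, X x ^ 4 ∂μ = ∫ x, s ^ 2 * X x ^ 4 ∂μ := (integral_const_mul _ _).symm
    _ ≤ ∫ x, 2 * (Real.exp (s * X x ^ 2) - 1) ∂μ := by
        refine integral_mono_of_nonneg (ae_of_all _ fun x => by positivity)
          ((hint.sub (integrable_const 1)).const_mul 2) (ae_of_all _ fun x => ?_)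
        have hx : 0 ≤ s * X x ^ 2 := by positivity
        linarith [Real.quadratic_le_exp_of_nonneg hx]
    _ = 2 * (∫ x, Real.exp (s * X x ^ 2) ∂μ - 1) := by
        rw [integral_const_mul, integral_sub hint (integrable_const 1)]
        simp

theorem integral_cond (s : Set Ω) (g : Ω → ℝ) :
    ∫ x, g x ∂μ[|s] = (μ.real s)⁻¹ * ∫ x in s, g x ∂μ := by
  rw [ProbabilityTheory.cond, integral_smul_measure, ENNReal.toReal_inv, smul_eq_mul, Measure.real]

end Integral

/-! ### Dyadic intervals -/

/-- The index of the half-open dyadic interval of length `2⁻ʲ` that contains `t`. -/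
def cell (j : ℕ) (t : I) : ℕ := ⌊(2 : ℝ) ^ j * (t : ℝ)⌋₊

theorem measurable_cell (j : ℕ) : Measurable (cell j) := by
  unfold cell
  fun_prop

theorem cell_eq_iff (j m : ℕ) (t : I) :
    cell j t = m ↔ (m : ℝ) ≤ 2 ^ j * (t : ℝ) ∧ 2 ^ j * (t : ℝ) < m + 1 := by
  unfold cell
  exact Nat.floor_eq_iff (mul_nonneg (by positivity) t.2.1)

theorem cell_le (j : ℕ) (t : I) : cell j t ≤ 2 ^ j := by
  unfold cell
  refine Nat.floor_le_of_le ?_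
  push_cast
  exact mul_le_of_le_one_right (by positivity) t.2.2

theorem cell_succ_div_two (j : ℕ) (t : I) : cell (j + 1) t / 2 = cell j t := by
  unfold cell
  rw [← Nat.floor_div_ofNat]
  congr 1
  rw [pow_succ]
  ring

theorem cell_mono {i j : ℕ} (h : i ≤ j) {s t : I} (hst : cell j s = cell j t) :
    cell i s = cell i t := by
  induction j, h using Nat.le_induction with
  | base => exact hst
  | succ k _ ih => exact ih (by rw [← cell_succ_div_two, hst, cell_succ_div_two])

theorem abs_sub_lt_of_cell_eq {j : ℕ} {s t : I} (h : cell j s = cell j t) :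
    |(s : ℝ) - t| < 1 / 2 ^ j := by
  obtain ⟨hs, hs'⟩ := (cell_eq_iff j _ s).1 h
  obtain ⟨ht, ht'⟩ := (cell_eq_iff j _ t).1 rfl
  rw [lt_div_iff₀ (by positivity), ← abs_of_pos (show (0 : ℝ) < 2 ^ j by positivity), ← abs_mul,
    abs_lt]
  constructor <;> linarith

theorem volume_real_cell_eq {j m : ℕ} (hm : m < 2 ^ j) :
    volume.real {t : I | cell j t = m} = 1 / 2 ^ j := by
  have hm' : (m : ℝ) + 1 ≤ 2 ^ j := by exact_mod_cast hm
  have hpow : (0 : ℝ) < 2 ^ j := by positivity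
  have hset : {t : I | cell j t = m} =
      Ico (⟨m / 2 ^ j, by positivity, by rw [div_le_one hpow]; linarith⟩ : I)
        ⟨(m + 1) / 2 ^ j, by positivity, by rwa [div_le_one hpow]⟩ := by
    ext t
    rw [mem_ofPred_eq, cell_eq_iff, mem_Ico, ← Subtype.coe_le_coe, ← Subtype.coe_lt_coe,
      div_le_iff₀ hpow, lt_div_iff₀ hpow, mul_comm]
  rw [hset, Measure.real, unitInterval.volume_Ico, ← sub_div, add_sub_cancel_left,
    ENNReal.toReal_ofReal (by positivity)]

theorem integral_comp_cell (j : ℕ) (h : ℕ → ℝ) :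
    ∫ t : I, h (cell j t) = (∑ m ∈ Finset.range (2 ^ j), h m) / 2 ^ j := by
  have hmeas : ∀ m, MeasurableSet {t : I | cell j t = m} := fun m =>
    measurable_cell j (measurableSet_singleton m)
  have hae : (fun t : I => h (cell j t)) =ᵐ[volume] fun t =>
      ∑ m ∈ Finset.range (2 ^ j), {t : I | cell j t = m}.indicator (fun _ => h m) t := by
    have hne_one : ∀ᵐ t : I, t ≠ 1 := by
      rw [ae_iff]
      simp
    filter_upwards [hne_one] with t ht
    have ht1 : (t : ℝ) < 1 := lt_of_le_of_ne t.2.2 fun h => ht (Subtype.ext h)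
    have hlt : cell j t < 2 ^ j := by
      unfold cell
      rw [Nat.floor_lt (mul_nonneg (by positivity) t.2.1)]
      push_cast
      exact mul_lt_of_lt_one_right (by positivity) ht1
    rw [Finset.sum_eq_single (cell j t)]
    · simp
    · intro b _ hb
      exact indicator_of_notMem (fun hmem => hb hmem.symm) _
    · intro hn
      exact absurd (Finset.mem_range.2 hlt) hn
  rw [integral_congr_ae hae, integral_finsetSum _ fun m _ =>
    (integrable_const (h m)).indicator (hmeas m), Finset.sum_div]
  refine Finset.sum_congr rfl fun m hm => ?_
  rw [integral_indicator_const _ (hmeas m), volume_real_cell_eq (Finset.mem_range.1 hm),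
    smul_eq_mul]
  ring

/-- `g` is constant on the dyadic intervals of length `2⁻ʲ`. -/
abbrev DyadicStep (j : ℕ) (g : I → ℝ) : Prop := g.FactorsThrough (cell j)

namespace DyadicStep

variable {i j : ℕ} {f g : I → ℝ}

theorem mono (h : i ≤ j) (hg : DyadicStep i g) : DyadicStep j g :=
  fun _ _ hst => hg (cell_mono h hst)

theorem const (c : ℝ) : DyadicStep j fun _ => c := fun _ _ _ => rfl

theorem mul (hf : DyadicStep j f) (hg : DyadicStep j g) : DyadicStep j fun t => f t * g t :=
  fun _ _ hst => congrArg₂ (· * ·) (hf hst) (hg hst)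

theorem add (hf : DyadicStep j f) (hg : DyadicStep j g) : DyadicStep j fun t => f t + g t :=
  fun _ _ hst => congrArg₂ (· + ·) (hf hst) (hg hst)

theorem prod {ι : Type*} {s : Finset ι} {F : ι → I → ℝ} (h : ∀ k ∈ s, DyadicStep j (F k)) :
    DyadicStep j fun t => ∏ k ∈ s, F k t :=
  fun _ _ hst => Finset.prod_congr rfl fun k hk => h k hk hst

theorem exists_eq (hg : DyadicStep j g) : ∃ h : ℕ → ℝ, ∀ t, g t = h (cell j t) := by
  obtain ⟨h, rfl⟩ := (Function.factorsThrough_iff g).1 hg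
  exact ⟨h, fun _ => rfl⟩

theorem measurable (hg : DyadicStep j g) : Measurable g := by
  obtain ⟨h, hh⟩ := hg.exists_eq
  rw [funext hh]
  exact (measurable_of_countable h).comp (measurable_cell j)

theorem exists_bound (hg : DyadicStep j g) : ∃ C, ∀ t, |g t| ≤ C := by
  obtain ⟨h, hh⟩ := hg.exists_eq
  refine ⟨∑ m ∈ Finset.range (2 ^ j + 1), |h m|, fun t => ?_⟩
  rw [hh]
  exact Finset.single_le_sum (f := fun m => |h m|) (fun _ _ => abs_nonneg _)
    (Finset.mem_range.2 (Nat.lt_succ_of_le (cell_le j t)))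

theorem integrable (hg : DyadicStep j g) : Integrable g (volume : Measure I) := by
  obtain ⟨C, hC⟩ := hg.exists_bound
  exact Integrable.of_bound hg.measurable.aestronglyMeasurable C (ae_of_all _ hC)

end DyadicStep

/-! ### Right continuous Walsh functions -/

/-- The right continuous version of the Rademacher function `r_k`, with values `±1`. -/
def radSign (k : ℕ) (t : I) : ℝ := (-1) ^ cell k t

/-- The right continuous version of the Walsh function `w_n`, with values `±1`. -/
def walshSign (n : ℕ) (t : I) : ℝ :=
  ∏ i ∈ Finset.range n.size, if n.testBit i then radSign (i + 1) t else 1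

theorem dyadicStep_radSign (k : ℕ) : DyadicStep k (radSign k) :=
  fun s t h => by unfold radSign; rw [h]

theorem radSign_mul_self (k : ℕ) (t : I) : radSign k t * radSign k t = 1 := by
  unfold radSign
  rw [← mul_pow]
  norm_num

theorem rademacher_eq_radSign {k : ℕ} {t : I} (h : ∀ m : ℕ, (2 : ℝ) ^ k * (t : ℝ) ≠ m) :
    rademacher k t = radSign k t := by
  obtain ⟨hle, hlt⟩ := (cell_eq_iff k _ t).1 rfl
  have hlt' := lt_of_le_of_ne hle (h _).symm
  unfold rademacher radSign
  set m := cell k t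
  have hshift : (2 : ℝ) ^ k * Real.pi * t = (2 ^ k * t - m) * Real.pi + m * Real.pi := by ring
  rw [hshift, Real.sin_add_nat_mul_pi]
  have hpos : 0 < Real.sin ((2 ^ k * t - m) * Real.pi) := by
    refine Real.sin_pos_of_pos_of_lt_pi (mul_pos (by linarith) Real.pi_pos) ?_
    exact mul_lt_of_lt_one_left Real.pi_pos (by linarith)
  rcases neg_one_pow_eq_or ℝ m with hm | hm
  · rw [hm, one_mul, Real.sign_of_pos hpos]
  · rw [hm, Real.sign_of_neg (by linarith)]

theorem ae_forall_two_pow_mul_ne : ∀ᵐ t : I, ∀ k m : ℕ, (2 : ℝ) ^ k * (t : ℝ) ≠ m := by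
  rw [ae_all_iff]
  intro k
  rw [ae_all_iff]
  intro m
  rw [ae_iff]
  simp only [not_not]
  refine Set.Subsingleton.measure_zero (fun s hs t ht => ?_) _
  refine Subtype.ext (mul_left_cancel₀ (show (2 : ℝ) ^ k ≠ 0 by positivity) ?_)
  exact Eq.trans hs (Eq.symm ht)

theorem walsh_ae_eq_walshSign (n : ℕ) : walsh n =ᵐ[volume] walshSign n := by
  filter_upwards [ae_forall_two_pow_mul_ne] with t ht
  unfold walsh walshSign
  refine Finset.prod_congr rfl fun i _ => ?_
  rw [rademacher_eq_radSign (ht _)]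

theorem walshSign_eq_prod_range {n M : ℕ} (h : n < 2 ^ M) (t : I) :
    walshSign n t = ∏ i ∈ Finset.range M, if n.testBit i then radSign (i + 1) t else 1 := by
  unfold walshSign
  refine Finset.prod_subset (Finset.range_subset_range.2 (Nat.size_le.2 h)) fun i _ hi => ?_
  rw [Finset.mem_range, not_lt, Nat.size_le] at hi
  rw [Nat.testBit_lt_two_pow hi]
  simp

theorem walshSign_mul (n m : ℕ) (t : I) :
    walshSign n t * walshSign m t = walshSign (n ^^^ m) t := by
  obtain ⟨M, hn, hm⟩ : ∃ M, n < 2 ^ M ∧ m < 2 ^ M :=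
    ⟨n + m, (Nat.lt_two_pow_self).trans_le (Nat.pow_le_pow_right two_pos (by omega)),
      (Nat.lt_two_pow_self).trans_le (Nat.pow_le_pow_right two_pos (by omega))⟩
  rw [walshSign_eq_prod_range hn, walshSign_eq_prod_range hm,
    walshSign_eq_prod_range (Nat.xor_lt_two_pow hn hm), ← Finset.prod_mul_distrib]
  refine Finset.prod_congr rfl fun i _ => ?_
  rw [Nat.testBit_xor]
  cases n.testBit i <;> cases m.testBit i <;> simp [radSign_mul_self]

@[simp] theorem walshSign_zero (t : I) : walshSign 0 t = 1 := by simp [walshSign]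

theorem walshSign_eq_one_or (n : ℕ) (t : I) : walshSign n t = 1 ∨ walshSign n t = -1 := by
  have h := walshSign_mul n n t
  rw [Nat.xor_self, walshSign_zero] at h
  exact mul_self_eq_one_iff.1 h

theorem dyadicStep_walshSign {n j : ℕ} (h : n < 2 ^ j) : DyadicStep j (walshSign n) := by
  rw [funext (walshSign_eq_prod_range h)]
  refine DyadicStep.prod fun i hi => ?_
  split_ifs
  · exact (dyadicStep_radSign _).mono (Finset.mem_range.1 hi)
  · exact DyadicStep.const 1

theorem integral_mul_radSign_succ {j : ℕ} {g : I → ℝ} (hg : DyadicStep j g) :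
    ∫ t, g t * radSign (j + 1) t = 0 := by
  obtain ⟨h, hh⟩ := hg.exists_eq
  have hcell : ∀ t, g t * radSign (j + 1) t =
      (fun m : ℕ => h (m / 2) * (-1) ^ m) (cell (j + 1) t) := fun t => by
    simp only [hh, radSign, cell_succ_div_two]
  have hcancel : ∀ N : ℕ, ∑ m ∈ Finset.range (2 * N), h (m / 2) * (-1 : ℝ) ^ m = 0 := by
    intro N
    induction N with
    | zero => simp
    | succ N ih =>
      rw [show 2 * (N + 1) = 2 * N + 1 + 1 by ring, Finset.sum_range_succ, Finset.sum_range_succ,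
        ih, show 2 * N / 2 = N by omega, show (2 * N + 1) / 2 = N by omega, pow_succ, pow_mul]
      simp
  refine (integral_congr_ae (ae_of_all _ hcell)).trans
    ((integral_comp_cell (j + 1) fun m => h (m / 2) * (-1) ^ m).trans ?_)
  rw [pow_succ', hcancel, zero_div]

theorem integral_mul_walshSign {j n : ℕ} {g : I → ℝ} (hg : DyadicStep j g) (hn : 2 ^ j ≤ n) :
    ∫ t, g t * walshSign n t = 0 := by
  have hn0 : n ≠ 0 := (lt_of_lt_of_le (by positivity) hn).ne'
  set k := Nat.log 2 n
  have hlt : n < 2 ^ (k + 1) := Nat.lt_pow_succ_log_self one_lt_two n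
  have hle : 2 ^ k ≤ n := Nat.pow_log_le_self 2 hn0
  have hjk : j ≤ k := (Nat.le_log_iff_pow_le one_lt_two hn0).2 hn
  have hbit : n.testBit k = true := Nat.testBit_of_two_pow_le_and_two_pow_add_one_gt hle hlt
  have hfactor : ∀ t, g t * walshSign n t =
      (g t * ∏ i ∈ Finset.range k, if n.testBit i then radSign (i + 1) t else 1) *
        radSign (k + 1) t := fun t => by
    rw [walshSign_eq_prod_range hlt, Finset.prod_range_succ, hbit, if_pos rfl, mul_assoc]
  simp_rw [hfactor]
  refine integral_mul_radSign_succ ((hg.mono hjk).mul (DyadicStep.prod fun i hi => ?_))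
  split_ifs
  · exact (dyadicStep_radSign _).mono (Finset.mem_range.1 hi)
  · exact DyadicStep.const 1

/-! ### Walsh sums on dyadic sets -/

theorem dyadicStep_indicator_preimage_cell (l : ℕ) (T : Set ℕ) :
    DyadicStep l ((cell l ⁻¹' T).indicator 1) :=
  fun _ _ hst => congrArg (T.indicator (1 : ℕ → ℝ)) hst

theorem measurableSet_preimage_cell (l : ℕ) (T : Set ℕ) : MeasurableSet (cell l ⁻¹' T) :=
  measurable_cell l T.to_countable.measurableSet

theorem exists_volume_symmDiff_preimage_cell_lt {E : Set I} (hE : NullMeasurableSet E volume)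
    {ε : ℝ≥0∞} (hε : ε ≠ 0) : ∃ l T, volume (E ∆ (cell l ⁻¹' T)) < ε := by
  obtain ⟨E', hE', hEE'⟩ := hE
  have hε2 : ε / 2 ≠ 0 := (ENNReal.half_pos hε).ne'
  obtain ⟨K, hKE, hK, -, hEK⟩ :=
    hE'.exists_isCompact_isClosed_sdiff_lt (measure_ne_top volume E') hε2
  obtain ⟨U, hEU, hU, -, hUE⟩ := hE'.exists_isOpen_sdiff_lt (measure_ne_top volume E') hε2
  obtain ⟨r, hr, hrU⟩ := hK.exists_thickening_subset_open hU (hKE.trans hEU)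
  obtain ⟨l, hl⟩ := exists_pow_lt_of_lt_one hr (one_half_lt_one (α := ℝ))
  have hKD : K ⊆ cell l ⁻¹' (cell l '' K) := subset_preimage_image _ _
  have hDU : cell l ⁻¹' (cell l '' K) ⊆ U := by
    rintro t ⟨s, hs, hst⟩
    refine hrU (Metric.mem_thickening_iff.2 ⟨s, hs, ?_⟩)
    rw [dist_comm, Subtype.dist_eq, Real.dist_eq]
    exact (abs_sub_lt_of_cell_eq hst).trans (by rwa [one_div_pow] at hl)
  refine ⟨l, cell l '' K, ?_⟩
  calc volume (E ∆ (cell l ⁻¹' (cell l '' K)))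
      = volume (E' ∆ (cell l ⁻¹' (cell l '' K))) :=
        measure_congr (hEE'.symmDiff (ae_eq_refl _))
    _ ≤ volume (E' \ K ∪ U \ E') :=
        measure_mono
          (union_subset_union (sdiff_subset_sdiff_right hKD) (sdiff_subset_sdiff_left hDU))
    _ ≤ volume (E' \ K) + volume (U \ E') := measure_union_le _ _
    _ < ε / 2 + ε / 2 := ENNReal.add_lt_add hEK hUE
    _ = ε := ENNReal.add_halves ε

variable {ι : Type*}

/-- The finite sum `∑ a_k w_{n_k}`, over `k ∈ F`, with the right continuous Walsh functions. -/
def walshSum (a : ι → ℝ) (n : ι → ℕ) (F : Finset ι) (t : I) : ℝ :=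
  ∑ k ∈ F, a k * walshSign (n k) t

theorem abs_walshSum_le (a : ι → ℝ) (n : ι → ℕ) (F : Finset ι) (t : I) :
    |walshSum a n F t| ≤ ∑ k ∈ F, |a k| := by
  refine (Finset.abs_sum_le_sum_abs _ _).trans (Finset.sum_le_sum fun k _ => ?_)
  rcases walshSign_eq_one_or (n k) t with h | h <;> simp [h]

theorem measurable_walshSign (n : ℕ) : Measurable (walshSign n) :=
  (dyadicStep_walshSign Nat.lt_two_pow_self).measurable

theorem measurable_walshSum (a : ι → ℝ) (n : ι → ℕ) (F : Finset ι) :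
    Measurable (walshSum a n F) :=
  Finset.measurable_fun_sum _ fun k _ => (measurable_walshSign (n k)).const_mul (a k)

theorem memLp_comp_walshSum (a : ι → ℝ) (n : ι → ℕ) (F : Finset ι) {g : ℝ → ℝ}
    (hg : Continuous g) (p : ℝ≥0∞) (μ : Measure I) [IsFiniteMeasure μ] :
    MemLp (fun t => g (walshSum a n F t)) p μ := by
  obtain ⟨C, hC⟩ := (isCompact_Icc (a := -∑ k ∈ F, |a k|)
    (b := ∑ k ∈ F, |a k|)).exists_bound_of_continuousOn hg.continuousOn
  exact MemLp.of_bound (hg.measurable.comp (measurable_walshSum a n F)).aestronglyMeasurable C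
    (ae_of_all _ fun t => hC _ (abs_le.1 (abs_walshSum_le a n F t)))

theorem exp_mul_walshSign (x : ℝ) (n : ℕ) (t : I) :
    Real.exp (x * walshSign n t) = Real.cosh x + Real.sinh x * walshSign n t := by
  rcases walshSign_eq_one_or n t with h | h
  · rw [h, mul_one, mul_one, Real.cosh_add_sinh]
  · rw [h, mul_neg_one, mul_neg_one, ← sub_eq_add_neg, Real.cosh_sub_sinh]

theorem exp_mul_walshSum (x : ℝ) (a : ι → ℝ) (n : ι → ℕ) (F : Finset ι) (t : I) :
    Real.exp (x * walshSum a n F t) =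
      ∏ k ∈ F, (Real.cosh (x * a k) + Real.sinh (x * a k) * walshSign (n k) t) := by
  rw [walshSum, Finset.mul_sum, Real.exp_sum]
  exact Finset.prod_congr rfl fun k _ => by rw [← exp_mul_walshSign, mul_assoc]

-- The factor with the largest leading digit integrates to `c k` against the others, which are
-- constant on its dyadic intervals.
theorem integral_mul_prod_walshSign {l : ℕ} {φ : I → ℝ} (hφ : DyadicStep l φ) {n : ι → ℕ}
    (c s : ι → ℝ) {F : Finset ι} (hn : ∀ k ∈ F, 2 ^ l ≤ n k)
    (hinj : Set.InjOn (fun k => Nat.log 2 (n k)) F) :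
    ∫ t, φ t * ∏ k ∈ F, (c k + s k * walshSign (n k) t) = (∫ t, φ t) * ∏ k ∈ F, c k := by
  classical
  induction F using Finset.induction_on_max_value (fun k => Nat.log 2 (n k)) with
  | empty => simp
  | insert m F hm hmax ih =>
    have hnm := hn m (Finset.mem_insert_self _ _)
    have hnm0 : n m ≠ 0 := (lt_of_lt_of_le (by positivity) hnm).ne'
    set j := Nat.log 2 (n m)
    have hstep : DyadicStep j fun t => φ t * ∏ k ∈ F, (c k + s k * walshSign (n k) t) := by
      refine (hφ.mono ((Nat.le_log_iff_pow_le one_lt_two hnm0).2 hnm)).mul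
        (DyadicStep.prod fun k hk => (DyadicStep.const _).add
          ((DyadicStep.const _).mul (dyadicStep_walshSign ?_)))
      have hne : Nat.log 2 (n k) ≠ j := fun h => hm
        (hinj (by simp [hk]) (by simp : m ∈ (insert m F : Finset ι)) h ▸ hk)
      exact Nat.lt_pow_of_log_lt one_lt_two (lt_of_le_of_ne (hmax k hk) hne)
    have hstep' := (hstep.mono (Nat.le_succ j)).mul
      (dyadicStep_walshSign (Nat.lt_pow_succ_log_self one_lt_two (n m)))
    calc ∫ t, φ t * ∏ k ∈ insert m F, (c k + s k * walshSign (n k) t)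
        = ∫ t, (c m * (φ t * ∏ k ∈ F, (c k + s k * walshSign (n k) t)) +
          s m * ((φ t * ∏ k ∈ F, (c k + s k * walshSign (n k) t)) * walshSign (n m) t)) := by
          refine integral_congr_ae (ae_of_all _ fun t => ?_)
          simp only [Finset.prod_insert hm]
          ring
      _ = c m * ∫ t, φ t * ∏ k ∈ F, (c k + s k * walshSign (n k) t) := by
          rw [integral_add (hstep.integrable.const_mul _) (hstep'.integrable.const_mul _),
            integral_const_mul, integral_const_mul,
            integral_mul_walshSign hstep (Nat.pow_log_le_self 2 hnm0), mul_zero, add_zero]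
      _ = _ := by
          rw [ih (fun k hk => hn k (Finset.mem_insert_of_mem hk)) (hinj.mono (by simp)),
            Finset.prod_insert hm]
          ring

theorem integral_indicator_preimage_cell_mul (l : ℕ) (T : Set ℕ) (g : I → ℝ) :
    ∫ t, (cell l ⁻¹' T).indicator 1 t * g t = ∫ t in cell l ⁻¹' T, g t := by
  rw [← integral_indicator (measurableSet_preimage_cell l T)]
  refine integral_congr_ae (ae_of_all _ fun t => ?_)
  by_cases ht : t ∈ cell l ⁻¹' T <;> simp [ht]

theorem hasSubgaussianMGF_walshSum_of_injOn {l : ℕ} {T : Set ℕ}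
    (hT : volume (cell l ⁻¹' T) ≠ 0) (a : ι → ℝ) {n : ι → ℕ} {F : Finset ι}
    (hn : ∀ k ∈ F, 2 ^ l ≤ n k) (hinj : Set.InjOn (fun k => Nat.log 2 (n k)) F) :
    HasSubgaussianMGF (walshSum a n F) (∑ k ∈ F, ‖a k‖₊ ^ 2) volume[|cell l ⁻¹' T] where
  integrable_exp_mul x :=
    (memLp_comp_walshSum a n F (g := fun y => Real.exp (x * y)) (by fun_prop) 1 _).integrable le_rfl
  mgf_le x := by
    have hD : volume.real (cell l ⁻¹' T) ≠ 0 := (ENNReal.toReal_pos hT (by finiteness)).ne'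
    calc mgf (walshSum a n F) volume[|cell l ⁻¹' T] x = ∏ k ∈ F, Real.cosh (x * a k) := by
          simp_rw [mgf, integral_cond, ← integral_indicator_preimage_cell_mul, exp_mul_walshSum]
          rw [integral_mul_prod_walshSign (dyadicStep_indicator_preimage_cell l T) _ _ hn hinj,
            integral_indicator_one (measurableSet_preimage_cell l T), inv_mul_cancel_left₀ hD]
      _ ≤ ∏ k ∈ F, Real.exp ((x * a k) ^ 2 / 2) :=
          Finset.prod_le_prod (fun k _ => (Real.cosh_pos _).le)
            fun k _ => Real.cosh_le_exp_half_sq _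
      _ = Real.exp ((∑ k ∈ F, ‖a k‖₊ ^ 2 : ℝ≥0) * x ^ 2 / 2) := by
          rw [← Real.exp_sum]
          push_cast
          simp only [Real.norm_eq_abs, sq_abs, Finset.sum_mul, Finset.sum_div]
          exact congrArg _ (Finset.sum_congr rfl fun k _ => by ring)

theorem hasSubgaussianMGF_finset_sum {Ω : Type*} [MeasurableSpace Ω] {μ : Measure Ω}
    [IsZeroOrProbabilityMeasure μ] (s : Finset ι) {X : ι → Ω → ℝ} {v : ι → ℝ≥0}
    (h : ∀ i ∈ s, HasSubgaussianMGF (X i) (v i) μ) :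
    HasSubgaussianMGF (fun ω => ∑ i ∈ s, X i ω) (s.card * ∑ i ∈ s, v i) μ := by
  classical
  induction s using Finset.induction_on with
  | empty => simp
  | insert i s hi ih =>
    have hadd := (h i (by simp)).add (ih fun j hj => h j (by simp [hj]))
    simp only [Finset.sum_insert hi, Finset.card_insert_of_notMem hi]
    refine ⟨hadd.integrable_exp_mul, fun t => (hadd.mgf_le t).trans ?_⟩
    gcongr
    rw [NNReal.sqrt_mul]
    have hCS : ∀ x y z : ℝ≥0, (x + z * y) ^ 2 ≤ (z ^ 2 + 1) * (x ^ 2 + y ^ 2) := fun x y z => by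
      rw [← NNReal.coe_le_coe]
      push_cast
      linarith [sq_nonneg (z * x - y : ℝ)]
    simpa using hCS (NNReal.sqrt (v i)) (NNReal.sqrt (∑ j ∈ s, v j)) (NNReal.sqrt s.card)

theorem log_injOn_mod_eq {L : ℕ} {n : ℕ → ℕ} (hpos : ∀ k, 0 < n k)
    (hL : ∀ k, 2 * n k ≤ n (k + L)) (i : ℕ) :
    Set.InjOn (fun k => Nat.log 2 (n k)) {k | k % L = i} := by
  have hmono : StrictMono fun m => Nat.log 2 (n (i + L * m)) :=
    strictMono_nat_of_lt_succ fun m =>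
      calc Nat.log 2 (n (i + L * m)) < Nat.log 2 (n (i + L * m) * 2) := by
            rw [Nat.log_mul_base one_lt_two (hpos _).ne']
            exact Nat.lt_succ_self _
        _ ≤ Nat.log 2 (n (i + L * (m + 1))) := Nat.log_mono_right (by
            rw [mul_comm, mul_add_one, ← add_assoc]
            exact hL _)
  intro k hk k' hk' h
  rw [mem_ofPred_eq] at hk hk'
  rw [← Nat.mod_add_div k L, ← Nat.mod_add_div k' L, hk, hk'] at h ⊢
  rw [hmono.injective h]

theorem hasSubgaussianMGF_walshSum {l : ℕ} {T : Set ℕ} (hT : volume (cell l ⁻¹' T) ≠ 0)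
    (a : ℕ → ℝ) {n : ℕ → ℕ} {L : ℕ} (hL0 : 0 < L) (hn : ∀ k, 2 ^ l ≤ n k)
    (hL : ∀ k, 2 * n k ≤ n (k + L)) (F : Finset ℕ) :
    HasSubgaussianMGF (walshSum a n F) (L * ∑ k ∈ F, ‖a k‖₊ ^ 2) volume[|cell l ⁻¹' T] := by
  have hmod : ∀ k ∈ F, k % L ∈ Finset.range L := fun k _ => Finset.mem_range.2 (Nat.mod_lt k hL0)
  have hclass (i : ℕ) : HasSubgaussianMGF (walshSum a n (F.filter fun k => k % L = i))
      (∑ k ∈ F with k % L = i, ‖a k‖₊ ^ 2) volume[|cell l ⁻¹' T] :=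
    hasSubgaussianMGF_walshSum_of_injOn hT a (fun k _ => hn k)
      ((log_injOn_mod_eq (fun k => (Nat.two_pow_pos l).trans_le (hn k)) hL i).mono
        fun k hk => (Finset.mem_filter.1 hk).2)
  have hsum := hasSubgaussianMGF_finset_sum (Finset.range L) fun i _ => hclass i
  rw [Finset.card_range, Finset.sum_fiberwise_of_maps_to hmod] at hsum
  exact hsum.congr (ae_of_all _ fun t => Finset.sum_fiberwise_of_maps_to hmod _)

theorem integral_mul_walshSum_sq {l : ℕ} {φ : I → ℝ} (hφ : DyadicStep l φ) {n : ι → ℕ}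
    (hn : ∀ j k, j ≠ k → 2 ^ l ≤ n j ^^^ n k) (a : ι → ℝ) (F : Finset ι) :
    ∫ t, φ t * walshSum a n F t ^ 2 = (∫ t, φ t) * ∑ k ∈ F, a k ^ 2 := by
  have hexpand (t : I) : φ t * walshSum a n F t ^ 2 =
      ∑ j ∈ F, ∑ k ∈ F, (a j * a k) * (φ t * walshSign (n j ^^^ n k) t) := by
    rw [walshSum, sq, Finset.sum_mul_sum, Finset.mul_sum]
    refine Finset.sum_congr rfl fun j _ => ?_
    rw [Finset.mul_sum]
    refine Finset.sum_congr rfl fun k _ => ?_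
    rw [← walshSign_mul]
    ring
  have hint (m : ℕ) : Integrable (fun t => φ t * walshSign m t) volume :=
    ((hφ.mono (Nat.le_add_right l m)).mul ((dyadicStep_walshSign Nat.lt_two_pow_self).mono
      (Nat.le_add_left m l))).integrable
  simp_rw [hexpand]
  rw [integral_finsetSum _ fun j _ => integrable_finsetSum _ fun k _ => (hint _).const_mul _,
    Finset.mul_sum]
  refine Finset.sum_congr rfl fun j hj => ?_
  rw [integral_finsetSum _ fun k _ => (hint _).const_mul _, Finset.sum_eq_single j]
  · rw [integral_const_mul, Nat.xor_self]
    simp only [walshSign_zero, mul_one]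
    ring
  · intro k _ hk
    rw [integral_const_mul, integral_mul_walshSign hφ (hn j k hk.symm), mul_zero]
  · exact fun h => absurd hj h

/-! ### From dyadic sets to measurable sets -/

section Localisation

variable {E : Set I} {l L : ℕ} {T : Set ℕ} {n : ℕ → ℕ}

theorem integral_exp_mul_walshSum_sq_le (hT : volume (cell l ⁻¹' T) ≠ 0) (hL0 : 0 < L)
    (hn : ∀ k, 2 ^ l ≤ n k) (hL : ∀ k, 2 * n k ≤ n (k + L)) (a : ℕ → ℝ) (F : Finset ℕ) {s : ℝ}
    (hs : 0 ≤ s) (hsa : 4 * (L * ∑ k ∈ F, a k ^ 2) * s ≤ 1) :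
    ∫ t, Real.exp (s * walshSum a n F t ^ 2) ∂volume[|cell l ⁻¹' T] ≤ 3 / 2 := by
  refine integral_exp_mul_sq_le_of_hasSubgaussianMGF (hasSubgaussianMGF_walshSum hT a hL0 hn hL F)
    hs ?_
  push_cast
  simp only [Real.norm_eq_abs, sq_abs]
  linarith

theorem integral_exp_mul_walshSum_sq_le_of_univ (hL0 : 0 < L) (hn : ∀ k, 0 < n k)
    (hL : ∀ k, 2 * n k ≤ n (k + L)) (a : ℕ → ℝ) (F : Finset ℕ) {s : ℝ} (hs : 0 ≤ s)
    (hsa : 4 * (L * ∑ k ∈ F, a k ^ 2) * s ≤ 1) :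
    ∫ t, Real.exp (s * walshSum a n F t ^ 2) ≤ 3 / 2 := by
  have h := integral_exp_mul_walshSum_sq_le (l := 0) (T := univ) (by simp) hL0 hn hL a F hs hsa
  rwa [preimage_univ, cond_univ] at h

theorem abs_volume_sub_volume_cell_le (hE : NullMeasurableSet E volume) (hL0 : 0 < L)
    (hED : √(volume.real (E ∆ (cell l ⁻¹' T))) ≤ volume.real E / (16 * L)) :
    |volume.real E - volume.real (cell l ⁻¹' T)| ≤ volume.real E / 16 := by
  have hL1 : (1 : ℝ) ≤ L := by exact_mod_cast hL0
  calc |volume.real E - volume.real (cell l ⁻¹' T)|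
      ≤ volume.real (E ∆ (cell l ⁻¹' T)) :=
        abs_measureReal_sub_le_measureReal_symmDiff hE
          (measurableSet_preimage_cell l T).nullMeasurableSet
    _ ≤ √(volume.real (E ∆ (cell l ⁻¹' T))) :=
        Real.le_sqrt_self_iff.2 measureReal_le_one
    _ ≤ volume.real E / (16 * L) := hED
    _ ≤ volume.real E / 16 := by
        gcongr
        linarith

theorem setIntegral_exp_mul_walshSum_sq_le (hE : NullMeasurableSet E volume)
    (hE0 : 0 < volume.real E) (hL0 : 0 < L)
    (hED : √(volume.real (E ∆ (cell l ⁻¹' T))) ≤ volume.real E / (16 * L))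
    (hn : ∀ k, 2 ^ l ≤ n k) (hL : ∀ k, 2 * n k ≤ n (k + L)) (a : ℕ → ℝ) (F : Finset ℕ) {s : ℝ}
    (hs : 0 ≤ s) (hsa : 8 * (L * ∑ k ∈ F, a k ^ 2) * s ≤ 1) :
    ∫ t in E, Real.exp (s * walshSum a n F t ^ 2) ≤ 2 * volume.real E := by
  have hexp : MemLp (fun t => Real.exp (s * walshSum a n F t ^ 2)) 2 volume :=
    memLp_comp_walshSum a n F (g := fun y => Real.exp (s * y ^ 2)) (by fun_prop) 2 volume
  have hvol := abs_le.1 (abs_volume_sub_volume_cell_le hE hL0 hED)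
  have hD0 : 0 < volume.real (cell l ⁻¹' T) := by linarith
  have hD : ∫ t in cell l ⁻¹' T, Real.exp (s * walshSum a n F t ^ 2) ≤
      volume.real (cell l ⁻¹' T) * (3 / 2) := by
    have h := integral_exp_mul_walshSum_sq_le
      ((measureReal_ne_zero_iff (measure_ne_top _ _)).1 hD0.ne') hL0 hn hL a F hs (by linarith)
    rwa [integral_cond, inv_mul_le_iff₀ hD0] at h
  have hsqrt : √(∫ t, Real.exp (s * walshSum a n F t ^ 2) ^ 2) ≤ 2 := by
    refine Real.sqrt_le_iff.2 ⟨zero_le_two, ?_⟩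
    simp_rw [← Real.exp_nat_mul, ← mul_assoc]
    push_cast
    linarith [integral_exp_mul_walshSum_sq_le_of_univ hL0
      (fun k => (Nat.two_pow_pos l).trans_le (hn k)) hL a F (s := 2 * s) (by linarith)
      (by linarith)]
  have hclose : √(volume.real (E ∆ (cell l ⁻¹' T))) *
      √(∫ t, Real.exp (s * walshSum a n F t ^ 2) ^ 2) ≤ volume.real E / 16 * 2 := by
    have hL1 : (1 : ℝ) ≤ L := by exact_mod_cast hL0
    gcongr
    exact hED.trans (div_le_div_of_nonneg_left hE0.le (by norm_num) (by linarith))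
  have hdiff := (le_abs_self _).trans (abs_setIntegral_sub_setIntegral_le hE
    (measurableSet_preimage_cell l T).nullMeasurableSet hexp)
  linarith

theorem le_setIntegral_walshSum_sq (hE : NullMeasurableSet E volume) (hL0 : 0 < L)
    (hED : √(volume.real (E ∆ (cell l ⁻¹' T))) ≤ volume.real E / (16 * L))
    (hn : ∀ k, 0 < n k) (hxor : ∀ j k, j ≠ k → 2 ^ l ≤ n j ^^^ n k)
    (hL : ∀ k, 2 * n k ≤ n (k + L)) (a : ℕ → ℝ) (F : Finset ℕ) :
    volume.real E * (∑ k ∈ F, a k ^ 2) / 2 ≤ ∫ t in E, walshSum a n F t ^ 2 := by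
  set v := ∑ k ∈ F, a k ^ 2
  have hv0 : 0 ≤ v := Finset.sum_nonneg fun k _ => sq_nonneg (a k)
  rcases hv0.eq_or_lt with hv | hv
  · rw [← hv, mul_zero, zero_div]
    exact integral_nonneg fun t => sq_nonneg _
  have hsqrt : √(∫ t, (walshSum a n F t ^ 2) ^ 2) ≤ 4 * (L * v) := by
    have hexp := integral_exp_mul_walshSum_sq_le_of_univ hL0 hn hL a F
      (s := (4 * (L * v))⁻¹) (by positivity) (mul_inv_cancel₀ (by positivity)).le
    have hpow := sq_mul_integral_pow_four_le (X := walshSum a n F) (μ := volume)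
      (s := (4 * (L * v))⁻¹) (by positivity) ((memLp_comp_walshSum a n F
        (g := fun y => Real.exp ((4 * (L * v))⁻¹ * y ^ 2)) (by fun_prop) 1 volume).integrable
          le_rfl)
    rw [inv_pow, inv_mul_le_iff₀ (by positivity)] at hpow
    refine Real.sqrt_le_iff.2 ⟨by positivity, ?_⟩
    simp_rw [← pow_mul]
    exact hpow.trans (mul_le_of_le_one_right (by positivity) (by linarith))
  have hD : ∫ t in cell l ⁻¹' T, walshSum a n F t ^ 2 = volume.real (cell l ⁻¹' T) * v := by
    have h := integral_mul_walshSum_sq (dyadicStep_indicator_preimage_cell l T) hxor a F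
    rwa [integral_indicator_one (measurableSet_preimage_cell l T),
      integral_indicator_preimage_cell_mul] at h
  have hclose : √(volume.real (E ∆ (cell l ⁻¹' T))) * √(∫ t, (walshSum a n F t ^ 2) ^ 2) ≤
      volume.real E * v / 4 :=
    calc _ ≤ volume.real E / (16 * L) * (4 * (L * v)) := by gcongr
      _ = volume.real E * v / 4 := by field
  have hdiff := (neg_abs_le _).trans' (neg_le_neg (abs_setIntegral_sub_setIntegral_le hE
    (measurableSet_preimage_cell l T).nullMeasurableSet
    (memLp_comp_walshSum a n F (g := fun y => y ^ 2) (by fun_prop) 2 volume)))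
  have hvol := abs_le.1 (abs_volume_sub_volume_cell_le hE hL0 hED)
  have := mul_le_mul_of_nonneg_right hvol.2 hv0
  linarith [mul_nonneg (measureReal_nonneg (μ := volume) (s := E)) hv0]

end Localisation

/-! ### Lacunary sequences -/

theorem xor_le_add (a b : ℕ) : a ^^^ b ≤ a + b := by
  induction a using Nat.strong_induction_on generalizing b with
  | _ a ih =>
    rcases Nat.eq_zero_or_pos a with rfl | ha
    · simp
    have hhalf := ih (a / 2) (by omega) (b / 2)
    have hdiv := Nat.xor_div_two (a := a) (b := b)
    have hmod := Nat.xor_mod_two_eq (m := a) (n := b)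
    omega

theorem le_add_xor (m n : ℕ) : n ≤ m + (m ^^^ n) :=
  calc n = m ^^^ (m ^^^ n) := by rw [← Nat.xor_assoc, Nat.xor_self, Nat.zero_xor]
    _ ≤ _ := xor_le_add _ _

theorem IsLacunary.mul_le_succ {q : ℝ} {n : ℕ → ℕ} (h : IsLacunary q n) (k : ℕ) :
    q * n k ≤ n (k + 1) := by
  obtain ⟨hpos, hratio⟩ := h k
  rwa [le_div_iff₀ (by exact_mod_cast hpos)] at hratio

theorem IsLacunary.pow_mul_le {q : ℝ} (hq : 1 < q) {n : ℕ → ℕ} (h : IsLacunary q n) (k m : ℕ) :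
    q ^ m * n k ≤ n (k + m) := by
  induction m with
  | zero => simp
  | succ m ih =>
    calc q ^ (m + 1) * n k = q * (q ^ m * n k) := by ring
      _ ≤ q * n (k + m) := by gcongr
      _ ≤ _ := h.mul_le_succ (k + m)

theorem IsLacunary.two_mul_le {q : ℝ} (hq : 1 < q) {n : ℕ → ℕ} (h : IsLacunary q n) {L : ℕ}
    (hL : 2 ≤ q ^ L) (k : ℕ) : 2 * n k ≤ n (k + L) := by
  have hreal : (2 : ℝ) * n k ≤ n (k + L) :=
    (mul_le_mul_of_nonneg_right hL (Nat.cast_nonneg _)).trans (h.pow_mul_le hq k L)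
  exact_mod_cast hreal

theorem IsLacunary.mul_le_of_lt {q : ℝ} (hq : 1 < q) {n : ℕ → ℕ} (h : IsLacunary q n) {j k : ℕ}
    (hjk : j < k) : q * n j ≤ n k := by
  obtain ⟨m, rfl⟩ := Nat.exists_eq_add_of_lt hjk
  refine le_trans ?_ (h.pow_mul_le hq j (m + 1))
  gcongr
  exact le_self_pow₀ hq.le (Nat.succ_ne_zero m)

theorem IsLacunary.strictMono {q : ℝ} (hq : 1 < q) {n : ℕ → ℕ} (h : IsLacunary q n) :
    StrictMono n := fun j k hjk => by
  have hpos : (0 : ℝ) < n j := by exact_mod_cast (h j).1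
  have hlt : (n j : ℝ) < n k := (lt_mul_of_one_lt_left hpos hq).trans_le (h.mul_le_of_lt hq hjk)
  exact_mod_cast hlt

theorem IsLacunary.le_xor {q : ℝ} (hq : 1 < q) {n : ℕ → ℕ} (h : IsLacunary q n) {M : ℕ}
    (hM : ∀ k, (M : ℝ) ≤ (q - 1) * n k) {j k : ℕ} (hjk : j ≠ k) : M ≤ n j ^^^ n k := by
  wlog hlt : j < k generalizing j k
  · rw [Nat.xor_comm]
    exact this hjk.symm (hjk.lt_or_gt.resolve_left hlt)
  have hratio := h.mul_le_of_lt hq hlt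
  have hxor : (n k : ℝ) ≤ n j + (n j ^^^ n k : ℕ) := by exact_mod_cast le_add_xor (n j) (n k)
  have hreal : (M : ℝ) ≤ (n j ^^^ n k : ℕ) := by linarith [hM j]
  exact_mod_cast hreal

/-- The Walsh functions `w_{n_k}` behave on `E`, with its normalized measure, like Rademacher
functions: their linear combinations are subgaussian, with a constant that is governed by `L`, and
their `L²` norms are bounded below by those of the coefficients. -/
structure IsRademacherLikeOn (L : ℕ) (E : Set I) (n : ℕ → ℕ) : Prop where
  integral_exp_le (a : ℕ → ℝ) (F : Finset ℕ) {s : ℝ} (hs : 0 ≤ s)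
    (hsa : 8 * (L * ∑ k ∈ F, a k ^ 2) * s ≤ 1) :
    ∫ t, Real.exp (s * walshSum a n F t ^ 2) ∂volume[|E] ≤ 2
  le_integral_sq (a : ℕ → ℝ) (F : Finset ℕ) :
    (∑ k ∈ F, a k ^ 2) / 2 ≤ ∫ t, walshSum a n F t ^ 2 ∂volume[|E]

theorem exists_isRademacherLikeOn {q : ℝ} (hq : 1 < q) {L : ℕ} (hL0 : 0 < L) (hL : 2 ≤ q ^ L)
    {E : Set I} (hE : NullMeasurableSet E volume) (hE0 : 0 < volume E) :
    ∃ N, ∀ n, IsLacunary q n → (∀ k, N ≤ n k) → IsRademacherLikeOn L E n := by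
  have hm : 0 < volume.real E := ENNReal.toReal_pos hE0.ne' (by finiteness)
  obtain ⟨l, T, hED⟩ := exists_volume_symmDiff_preimage_cell_lt hE
    (ε := ENNReal.ofReal ((volume.real E / (16 * L)) ^ 2))
    (ENNReal.ofReal_pos.2 (by positivity)).ne'
  have hED' : √(volume.real (E ∆ (cell l ⁻¹' T))) ≤ volume.real E / (16 * L) :=
    Real.sqrt_le_iff.2 ⟨by positivity, ENNReal.toReal_le_of_le_ofReal (by positivity) hED.le⟩
  obtain ⟨M, hM⟩ := exists_nat_ge ((2 ^ l : ℕ) / (q - 1))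
  refine ⟨max (2 ^ l) M, fun n hn hN => ?_⟩
  have hpow (k : ℕ) : 2 ^ l ≤ n k := (le_max_left _ _).trans (hN k)
  have hxor (j k : ℕ) (hjk : j ≠ k) : 2 ^ l ≤ n j ^^^ n k := by
    refine hn.le_xor hq (fun k => ?_) hjk
    rw [mul_comm, ← div_le_iff₀ (by linarith)]
    exact hM.trans (by exact_mod_cast (le_max_right _ _).trans (hN k))
  refine ⟨fun a F s hs hsa => ?_, fun a F => ?_⟩
  · rw [integral_cond, inv_mul_le_iff₀ hm, mul_comm]
    exact setIntegral_exp_mul_walshSum_sq_le hE hm hL0 hED' hpow (hn.two_mul_le hq hL) a F hs hsa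
  · rw [integral_cond, le_inv_mul_iff₀ hm, ← mul_div_assoc]
    exact le_setIntegral_walshSum_sq hE hL0 hED' (fun k => (hn k).1) hxor (hn.two_mul_le hq hL) a F

theorem exists_isRademacherLikeOn_of_isLacunary {q : ℝ} (hq : 1 < q) :
    ∃ L, 0 < L ∧ ∀ E : Set I, NullMeasurableSet E volume → 0 < volume E →
      ∃ N, ∀ n, IsLacunary q n → (∀ k, N ≤ n k) → IsRademacherLikeOn L E n := by
  obtain ⟨L, hL⟩ := pow_unbounded_of_one_lt 2 hq
  have hL0 : 0 < L := Nat.pos_of_ne_zero fun h => by norm_num [h] at hL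
  exact ⟨L, hL0, fun E hE hE0 => exists_isRademacherLikeOn hq hL0 hL.le hE hE0⟩

/-! ### Square-summable Walsh series -/

section Limits

variable {Ω : Type*} [MeasurableSpace Ω] {μ ν : Measure Ω}

theorem lintegral_comp_le_of_tendstoInMeasure {U : ℕ → Ω → ℝ} {f : Ω → ℝ}
    (hU : TendstoInMeasure μ U atTop f) (hν : ν ≪ μ) (hUm : ∀ M, AEMeasurable (U M) ν)
    {ψ : ℝ → ℝ≥0∞} (hψ : Continuous ψ) {b : ℝ≥0∞} (hb : ∀ M, ∫⁻ t, ψ (U M t) ∂ν ≤ b) :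
    ∫⁻ t, ψ (f t) ∂ν ≤ b := by
  obtain ⟨ns, -, hns⟩ := hU.exists_seq_tendsto_ae
  calc ∫⁻ t, ψ (f t) ∂ν
      = ∫⁻ t, liminf (fun i => ψ (U (ns i) t)) atTop ∂ν := by
        refine lintegral_congr_ae (hν.ae_le ?_)
        filter_upwards [hns] with t ht
        exact (((hψ.tendsto _).comp ht).liminf_eq).symm
    _ ≤ liminf (fun i => ∫⁻ t, ψ (U (ns i) t) ∂ν) atTop :=
        lintegral_liminf_le' fun i => hψ.measurable.comp_aemeasurable (hUm (ns i))
    _ ≤ b := (liminf_le_liminf (Eventually.of_forall fun i => hb (ns i))).trans (by simp)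

theorem continuous_integral_sq_cond (s : Set Ω) :
    Continuous fun g : Lp ℝ 2 μ => ∫ t, g t ^ 2 ∂μ[|s] := by
  have hnorm (g : Lp ℝ 2 μ) :
      ∫ t in s, g t ^ 2 ∂μ = ‖LpToLpRestrictCLM Ω ℝ ℝ μ 2 s g‖ ^ 2 := by
    rw [← real_inner_self_eq_norm_sq, L2.inner_def]
    refine integral_congr_ae ?_
    filter_upwards [LpToLpRestrictCLM_coeFn ℝ s g] with t ht
    simp [ht, sq]
  simp only [integral_cond, hnorm]
  fun_prop

end Limits

theorem coeFn_walshL2 (n : ℕ) : walshL2 n =ᵐ[volume] walshSign n :=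
  (MemLp.coeFn_toLp (memLp_walsh n)).trans (walsh_ae_eq_walshSign n)

theorem orthonormal_walshL2 : Orthonormal ℝ walshL2 := by
  rw [orthonormal_iff_ite]
  intro m n
  have hinner : inner ℝ (walshL2 m) (walshL2 n) = ∫ t, 1 * walshSign (m ^^^ n) t := by
    rw [L2.inner_def]
    refine integral_congr_ae ?_
    filter_upwards [coeFn_walshL2 m, coeFn_walshL2 n] with t hm hn
    rw [hm, hn, one_mul, ← walshSign_mul, real_inner_eq_re_inner]
    simp [mul_comm]
  rw [hinner]
  split_ifs with h
  · simp [h]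
  · refine integral_mul_walshSign (DyadicStep.const (j := 0) 1) ?_
    exact Nat.one_le_iff_ne_zero.2 fun h0 => h (Nat.xor_eq_zero_iff.1 h0)

theorem summable_smul_walshL2 {n : ℕ → ℕ} (hn : Function.Injective n) {a : ℕ → ℝ}
    (ha : Summable fun k => a k ^ 2) : Summable fun k => a k • walshL2 (n k) := by
  have h := (orthonormal_walshL2.comp n hn).orthogonalFamily.summable_iff_norm_sq_summable a
  simp only [LinearIsometry.toSpanSingleton_apply, Function.comp_apply, Real.norm_eq_abs,
    sq_abs] at h
  exact h.2 ha

theorem coeFn_sum_walshL2 (a : ℕ → ℝ) (n : ℕ → ℕ) (F : Finset ℕ) :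
    (∑ k ∈ F, a k • walshL2 (n k) : Lp ℝ 2 (volume : Measure I)) =ᵐ[volume]
      walshSum a n F := by
  have hsum := Lp.coeFn_finsetSum (μ := (volume : Measure I)) F fun k => a k • walshL2 (n k)
  have hterm : ∀ᵐ t : I, ∀ k ∈ F, (a k • walshL2 (n k) : Lp ℝ 2 (volume : Measure I)) t =
      a k * walshSign (n k) t := by
    refine (ae_ball_iff F.countable_toSet).2 fun k _ => ?_
    filter_upwards [Lp.coeFn_smul (a k) (walshL2 (n k)), coeFn_walshL2 (n k)] with t hsmul hwalsh
    rw [hsmul, Pi.smul_apply, hwalsh, smul_eq_mul]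
  filter_upwards [hsum, hterm] with t hsum hterm
  rw [hsum, Finset.sum_apply]
  exact Finset.sum_congr rfl hterm

namespace IsRademacherLikeOn

variable {L : ℕ} {E : Set I} {n : ℕ → ℕ}

theorem shift (h : IsRademacherLikeOn L E n) (K : ℕ) :
    IsRademacherLikeOn L E fun k => n (k + K) := by
  have hsum (a : ℕ → ℝ) (F : Finset ℕ) :
      walshSum a (fun k => n (k + K)) F =
        walshSum (fun k => a (k - K)) n (F.map (addRightEmbedding K)) := by
    funext t
    simp [walshSum]
  refine ⟨fun a F s hs hsa => ?_, fun a F => ?_⟩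
  · rw [hsum]
    exact h.integral_exp_le _ _ hs (by simpa using hsa)
  · rw [hsum]
    simpa using h.le_integral_sq (fun k => a (k - K)) (F.map (addRightEmbedding K))

variable {a : ℕ → ℝ} {f : Lp ℝ 2 (volume : Measure I)}

theorem lintegral_exp_le (h : IsRademacherLikeOn L E n) (ha : Summable fun k => a k ^ 2)
    (hf : HasSum (fun k => a k • walshL2 (n k)) f) {s : ℝ} (hs : 0 ≤ s)
    (hsa : 8 * (L * ∑' k, a k ^ 2) * s ≤ 1) :
    ∫⁻ t, ENNReal.ofReal (Real.exp (s * f t ^ 2)) ∂volume[|E] ≤ 2 := by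
  refine lintegral_comp_le_of_tendstoInMeasure (tendstoInMeasure_of_tendsto_Lp hf.tendsto_sum_nat)
    cond_absolutelyContinuous (fun M => (Lp.stronglyMeasurable _).measurable.aemeasurable)
    (ψ := fun x => ENNReal.ofReal (Real.exp (s * x ^ 2)))
    (ENNReal.continuous_ofReal.comp (by fun_prop)) fun M => ?_
  have hle : ∑ k ∈ Finset.range M, a k ^ 2 ≤ ∑' k, a k ^ 2 :=
    ha.sum_le_tsum _ fun _ _ => sq_nonneg _
  have hint := h.integral_exp_le a (Finset.range M) hs (le_trans (by gcongr) hsa)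
  calc _ = ∫⁻ t, ENNReal.ofReal (Real.exp (s * walshSum a n (Finset.range M) t ^ 2))
          ∂volume[|E] := by
        refine lintegral_congr_ae (cond_absolutelyContinuous.ae_le ?_)
        filter_upwards [coeFn_sum_walshL2 a n (Finset.range M)] with t ht
        rw [ht]
    _ = ENNReal.ofReal (∫ t, Real.exp (s * walshSum a n (Finset.range M) t ^ 2) ∂volume[|E]) :=
        (ofReal_integral_eq_lintegral_ofReal
          ((memLp_comp_walshSum a n _ (g := fun x => Real.exp (s * x ^ 2)) (by fun_prop) 1
            _).integrable le_rfl)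
          (ae_of_all _ fun t => (Real.exp_pos _).le)).symm
    _ ≤ 2 := by simpa using ENNReal.ofReal_le_ofReal hint

theorem half_tsum_sq_le_integral_sq (h : IsRademacherLikeOn L E n)
    (ha : Summable fun k => a k ^ 2) (hf : HasSum (fun k => a k • walshL2 (n k)) f) :
    (∑' k, a k ^ 2) / 2 ≤ ∫ t, f t ^ 2 ∂volume[|E] := by
  refine le_of_tendsto_of_tendsto' (ha.hasSum.tendsto_sum_nat.div_const 2)
    (((continuous_integral_sq_cond E).tendsto f).comp hf.tendsto_sum_nat) fun M => ?_
  refine (h.le_integral_sq a (Finset.range M)).trans_eq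
    (integral_congr_ae (cond_absolutelyContinuous.ae_le ?_))
  filter_upwards [coeFn_sum_walshL2 a n (Finset.range M)] with t ht
  rw [ht]

theorem integrable_exp (h : IsRademacherLikeOn L E n) (ha : Summable fun k => a k ^ 2)
    (hf : HasSum (fun k => a k • walshL2 (n k)) f) {s : ℝ} (hs : 0 ≤ s)
    (hsa : 8 * (L * ∑' k, a k ^ 2) * s ≤ 1) :
    Integrable (fun t => Real.exp (s * f t ^ 2)) volume[|E] :=
  (lintegral_ofReal_ne_top_iff_integrable (by fun_prop)
    (ae_of_all _ fun t => (Real.exp_pos _).le)).1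
    ((h.lintegral_exp_le ha hf hs hsa).trans_lt ENNReal.ofNat_lt_top).ne

theorem integral_pow_four_le (h : IsRademacherLikeOn L E n) (hE : volume E ≠ 0) (hL : 0 < L)
    (ha : Summable fun k => a k ^ 2) (hf : HasSum (fun k => a k • walshL2 (n k)) f)
    (hv : 0 < ∑' k, a k ^ 2) :
    ∫ t, f t ^ 4 ∂volume[|E] ≤ 2 * (8 * (L * ∑' k, a k ^ 2)) ^ 2 := by
  have := cond_isProbabilityMeasure hE
  have hs : 0 ≤ (8 * (L * ∑' k, a k ^ 2))⁻¹ := by positivity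
  have hsa := (mul_inv_cancel₀ (show 8 * (L * ∑' k, a k ^ 2) ≠ 0 by positivity)).le
  have hexp : ∫ t, Real.exp ((8 * (L * ∑' k, a k ^ 2))⁻¹ * f t ^ 2) ∂volume[|E] ≤ 2 := by
    rw [integral_eq_lintegral_of_nonneg_ae (ae_of_all _ fun t => (Real.exp_pos _).le)
      (h.integrable_exp ha hf hs hsa).aestronglyMeasurable]
    exact ENNReal.toReal_mono (by simp) (h.lintegral_exp_le ha hf hs hsa)
  have hfour := sq_mul_integral_pow_four_le hs (h.integrable_exp ha hf hs hsa)
  rw [inv_pow, inv_mul_le_iff₀ (by positivity), mul_comm] at hfour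
  refine hfour.trans ?_
  gcongr
  linarith

theorem le_measureReal_lt_sq (h : IsRademacherLikeOn L E n) (hE : volume E ≠ 0) (hL : 0 < L)
    (ha : Summable fun k => a k ^ 2) (hf : HasSum (fun k => a k • walshL2 (n k)) f)
    (hv : 0 < ∑' k, a k ^ 2) :
    1 / (2048 * (L : ℝ) ^ 2) ≤ volume[|E].real {t | (∑' k, a k ^ 2) / 4 < f t ^ 2} := by
  have := cond_isProbabilityMeasure hE
  have hsq := h.half_tsum_sq_le_integral_sq ha hf
  have hfour := h.integral_pow_four_le hE hL ha hf hv
  have hmem : MemLp (fun t => f t ^ 2) 2 volume[|E] :=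
    memLp_two_sq_of_integrable_exp (s := (8 * (L * ∑' k, a k ^ 2))⁻¹) (by fun_prop) (by positivity)
      (h.integrable_exp ha hf (by positivity) (mul_inv_cancel₀ (by positivity)).le)
  have hPZ := sq_integral_sub_le_measureReal_mul hmem (by positivity) (by linarith)
    (θ := (∑' k, a k ^ 2) / 4)
  simp only [← pow_mul] at hPZ
  set v := ∑' k, a k ^ 2
  set p := volume[|E].real {t | v / 4 < f t ^ 2}
  have hlow : (v / 4) ^ 2 ≤ p * (2 * (8 * (L * v)) ^ 2) :=
    calc (v / 4) ^ 2 ≤ (∫ t, f t ^ 2 ∂volume[|E] - v / 4) ^ 2 := by gcongr; linarith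
      _ ≤ p * ∫ t, f t ^ (2 * 2) ∂volume[|E] := hPZ
      _ ≤ p * (2 * (8 * (L * v)) ^ 2) := by gcongr
  rw [div_le_iff₀ (by positivity)]
  refine le_of_mul_le_mul_right ?_ (show 0 < v ^ 2 by positivity)
  linarith

end IsRademacherLikeOn

/-! ### Hearts of Orlicz spaces -/

/-- An Orlicz function, given on the whole real line. -/
structure IsOrliczFunction (Φ : ℝ → ℝ) : Prop where
  convexOn : ConvexOn ℝ univ Φ
  map_zero : Φ 0 = 0
  pos : ∀ x, x ≠ 0 → 0 < Φ x

/-- The modular `∫ Φ(|f| / c)` of the Orlicz space generated by `Φ`. -/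
def modular (Φ : ℝ → ℝ) (c : ℝ) (f : L0) : ℝ≥0∞ :=
  ∫⁻ t : I, ENNReal.ofReal (Φ (|f t| / c))

/-- The heart of the Orlicz space generated by `Φ`: the functions all of whose modulars are
finite. -/
def orliczHeart (Φ : ℝ → ℝ) : Set L0 :=
  {f | ∀ c : ℝ, 0 < c → modular Φ c f < ∞}

theorem orliczNorm_le_of_modular_le {Φ : ℝ → ℝ} {f : L0} {c : ℝ} (hc : 0 < c)
    (h : modular Φ c f ≤ 1) : orliczNorm Φ f ≤ ENNReal.ofReal c :=
  iInf₂_le c ⟨hc, h⟩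

theorem exists_modular_le_of_orliczNorm_lt {Φ : ℝ → ℝ} {f : L0} {b : ℝ}
    (h : orliczNorm Φ f < ENNReal.ofReal b) : ∃ c, 0 < c ∧ c < b ∧ modular Φ c f ≤ 1 := by
  simp only [orliczNorm, iInf_lt_iff] at h
  obtain ⟨c, ⟨hc, hle⟩, hcb⟩ := h
  exact ⟨c, hc, (ENNReal.ofReal_lt_ofReal_iff_of_nonneg hc.le).1 hcb, hle⟩

namespace IsOrliczFunction

variable {Φ : ℝ → ℝ}

theorem continuous (hΦ : IsOrliczFunction Φ) : Continuous Φ :=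
  continuousOn_univ.1 (hΦ.convexOn.continuousOn isOpen_univ)

theorem nonneg (hΦ : IsOrliczFunction Φ) (x : ℝ) : 0 ≤ Φ x := by
  rcases eq_or_ne x 0 with rfl | hx
  · exact hΦ.map_zero.ge
  · exact (hΦ.pos x hx).le

theorem map_mul_le (hΦ : IsOrliczFunction Φ) {r : ℝ} (hr0 : 0 ≤ r) (hr1 : r ≤ 1) (x : ℝ) :
    Φ (r * x) ≤ r * Φ x := by
  have h := hΦ.convexOn.2 (mem_univ x) (mem_univ 0) hr0 (sub_nonneg.2 hr1) (by ring)
  simpa only [smul_eq_mul, mul_zero, add_zero, hΦ.map_zero] using h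

theorem monotoneOn (hΦ : IsOrliczFunction Φ) : MonotoneOn Φ (Ici 0) := by
  intro x hx y _ hxy
  rcases (mem_Ici.1 hx).eq_or_lt with rfl | hx0
  · exact hΦ.map_zero.trans_le (hΦ.nonneg y)
  have hy0 : 0 < y := hx0.trans_le hxy
  have hr : x / y ≤ 1 := (div_le_one hy0).2 hxy
  calc Φ x = Φ (x / y * y) := by rw [div_mul_cancel₀ _ hy0.ne']
    _ ≤ x / y * Φ y := hΦ.map_mul_le (by positivity) hr y
    _ ≤ Φ y := mul_le_of_le_one_left (hΦ.nonneg y) hr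

theorem map_half_add_le (hΦ : IsOrliczFunction Φ) (x y : ℝ) :
    Φ ((x + y) / 2) ≤ Φ x + Φ y := by
  have h := hΦ.convexOn.2 (mem_univ x) (mem_univ y) one_half_pos.le one_half_pos.le (add_halves 1)
  simp only [smul_eq_mul] at h
  rw [show (x + y) / 2 = 1 / 2 * x + 1 / 2 * y by ring]
  linarith [hΦ.nonneg x, hΦ.nonneg y]

theorem le_one_add_div (hΦ : IsOrliczFunction Φ) (x : ℝ) : x ≤ 1 + Φ x / Φ 1 := by
  have hΦ1 : 0 < Φ 1 := hΦ.pos 1 one_ne_zero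
  rcases le_total x 1 with hx | hx
  · have := div_nonneg (hΦ.nonneg x) hΦ1.le
    linarith
  · have hx0 : 0 < x := one_pos.trans_le hx
    have h := hΦ.map_mul_le (inv_nonneg.2 hx0.le) (inv_le_one_of_one_le₀ hx) x
    rw [inv_mul_cancel₀ hx0.ne', le_inv_mul_iff₀ hx0, ← le_div_iff₀ hΦ1] at h
    linarith

theorem modular_mono (hΦ : IsOrliczFunction Φ) {f g : L0} {c d : ℝ} (hc : 0 < c) (hd : 0 < d)
    (h : ∀ᵐ t : I, |f t| / c ≤ |g t| / d) : modular Φ c f ≤ modular Φ d g := by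
  refine lintegral_mono_ae ?_
  filter_upwards [h] with t ht
  exact ENNReal.ofReal_le_ofReal
    (hΦ.monotoneOn (mem_Ici.2 (by positivity)) (mem_Ici.2 (by positivity)) ht)

theorem modular_anti (hΦ : IsOrliczFunction Φ) (f : L0) {c d : ℝ} (hc : 0 < c) (hcd : c ≤ d) :
    modular Φ d f ≤ modular Φ c f :=
  hΦ.modular_mono (hc.trans_le hcd) hc (ae_of_all _ fun t => by gcongr)

theorem modular_mul_le (hΦ : IsOrliczFunction Φ) (f : L0) {r c : ℝ} (hr : 1 ≤ r) :
    modular Φ (r * c) f ≤ ENNReal.ofReal r⁻¹ * modular Φ c f := by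
  have hr0 : 0 ≤ r⁻¹ := by positivity
  rw [modular, modular, ← lintegral_const_mul' _ _ ENNReal.ofReal_ne_top]
  refine lintegral_mono fun t => ?_
  rw [← ENNReal.ofReal_mul hr0, mul_comm r, ← div_div, div_eq_inv_mul _ r]
  exact ENNReal.ofReal_le_ofReal (hΦ.map_mul_le hr0 (inv_le_one_of_one_le₀ hr) _)

theorem modular_two_mul_add_le (hΦ : IsOrliczFunction Φ) (f g : L0) {c : ℝ} (hc : 0 < c) :
    modular Φ (2 * c) (f + g) ≤ modular Φ c f + modular Φ c g := by
  have hm : Measurable fun t : I => ENNReal.ofReal (Φ (|f t| / c)) :=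
    ENNReal.measurable_ofReal.comp (hΦ.continuous.measurable.comp (f.measurable.abs.div_const c))
  rw [modular, modular, modular, ← lintegral_add_left hm]
  refine lintegral_mono_ae ?_
  filter_upwards [AEEqFun.coeFn_add f g] with t ht
  rw [ht, ← ENNReal.ofReal_add (hΦ.nonneg _) (hΦ.nonneg _)]
  refine ENNReal.ofReal_le_ofReal (le_trans ?_ (hΦ.map_half_add_le _ _))
  refine hΦ.monotoneOn (mem_Ici.2 (by positivity)) (mem_Ici.2 (by positivity)) ?_
  rw [Pi.add_apply, ← add_div, div_div, mul_comm c 2]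
  gcongr
  exact abs_add_le _ _

theorem mem_orliczHeart_of_mem_Lp (hΦ : IsOrliczFunction Φ) {f : L0}
    (hf : f ∈ Lp ℝ ∞ (volume : Measure I)) : f ∈ orliczHeart Φ := by
  intro c hc
  set R := (eLpNorm f ∞ (volume : Measure I)).toReal
  have hfR : ∀ᵐ t : I, |f t| ≤ R := by
    have hfin := (Lp.mem_Lp_iff_memLp.1 hf).2.ne
    filter_upwards [ae_le_eLpNormEssSup (f := f) (μ := (volume : Measure I))] with t ht
    rw [← Real.norm_eq_abs, ← toReal_enorm]
    exact ENNReal.toReal_mono hfin (by rwa [eLpNorm_exponent_top])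
  have hle : modular Φ c f ≤ ∫⁻ _ : I, ENNReal.ofReal (Φ (R / c)) := by
    refine lintegral_mono_ae ?_
    filter_upwards [hfR] with t ht
    have hdiv : |f t| / c ≤ R / c := by gcongr
    have h0 : 0 ≤ |f t| / c := by positivity
    exact ENNReal.ofReal_le_ofReal (hΦ.monotoneOn h0 (h0.trans hdiv) hdiv)
  exact hle.trans_lt (by simp)

theorem mem_orliczHeart_of_forall_exists_sub (hΦ : IsOrliczFunction Φ) {f : L0}
    (h : ∀ c : ℝ, 0 < c → ∃ g ∈ Lp ℝ ∞ (volume : Measure I), modular Φ c (f - g) ≤ 1) :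
    f ∈ orliczHeart Φ := by
  intro c hc
  obtain ⟨g, hg, hfg⟩ := h (c / 2) (by positivity)
  calc modular Φ c f = modular Φ (2 * (c / 2)) (f - g + g) := by
        rw [sub_add_cancel, mul_div_cancel₀ c two_ne_zero]
    _ ≤ modular Φ (c / 2) (f - g) + modular Φ (c / 2) g :=
        hΦ.modular_two_mul_add_le _ _ (by positivity)
    _ < ∞ := ENNReal.add_lt_top.2
        ⟨hfg.trans_lt ENNReal.one_lt_top, hΦ.mem_orliczHeart_of_mem_Lp hg _ (by positivity)⟩

theorem orliczNorm_lt_top_of_mem_orliczHeart (hΦ : IsOrliczFunction Φ) {f : L0}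
    (hf : f ∈ orliczHeart Φ) : orliczNorm Φ f < ∞ := by
  set K := (modular Φ 1 f).toReal
  have hK : modular Φ 1 f = ENNReal.ofReal K := (ENNReal.ofReal_toReal (hf 1 one_pos).ne).symm
  have hK0 : 0 ≤ K := ENNReal.toReal_nonneg
  refine (orliczNorm_le_of_modular_le (c := (1 + K) * 1) (by positivity) ?_).trans_lt
    ENNReal.ofReal_lt_top
  refine (hΦ.modular_mul_le f (by linarith)).trans ?_
  rw [hK, ← ENNReal.ofReal_mul (by positivity), ENNReal.ofReal_le_one,
    inv_mul_le_iff₀ (by positivity)]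
  linarith

theorem exists_mem_Lp_modular_sub_le (hΦ : IsOrliczFunction Φ) {f : L0}
    (hf : f ∈ orliczHeart Φ) {c : ℝ} (hc : 0 < c) :
    ∃ g ∈ Lp ℝ ∞ (volume : Measure I), modular Φ c (f - g) ≤ 1 := by
  have hfm : AEStronglyMeasurable f (volume : Measure I) := f.aestronglyMeasurable
  have hψ : Continuous fun x => ENNReal.ofReal (Φ (|x| / c)) :=
    ENNReal.continuous_ofReal.comp (hΦ.continuous.comp (by fun_prop))
  have hlim : Tendsto (fun R : ℕ => ∫⁻ t : I,
      ENNReal.ofReal (Φ (|f t - truncation f R t| / c))) atTop (𝓝 (∫⁻ _ : I, 0)) := by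
    refine tendsto_lintegral_of_dominated_convergence' (fun t => ENNReal.ofReal (Φ (|f t| / c)))
      (fun R => ?_) (fun R => ae_of_all _ fun t => ?_) (hf c hc).ne (ae_of_all _ fun t => ?_)
    · exact hψ.measurable.comp_aemeasurable (hfm.sub hfm.truncation).aemeasurable
    · refine ENNReal.ofReal_le_ofReal (hΦ.monotoneOn (mem_Ici.2 (by positivity))
        (mem_Ici.2 (by positivity)) (div_le_div_of_nonneg_right ?_ hc.le))
      by_cases ht : f t ∈ Ioc (-R : ℝ) R <;> simp [truncation, ht]
    · obtain ⟨R₀, hR₀⟩ := exists_nat_gt |f t|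
      refine tendsto_const_nhds.congr' ?_
      filter_upwards [eventually_ge_atTop R₀] with R hR
      rw [truncation_eq_self (hR₀.trans_le (by exact_mod_cast hR))]
      simp [hΦ.map_zero]
  rw [lintegral_zero] at hlim
  obtain ⟨R, hR⟩ := (hlim.eventually_le_const (zero_lt_one (α := ℝ≥0∞))).exists
  have hg : MemLp (truncation f R) ∞ (volume : Measure I) := hfm.memLp_truncation
  refine ⟨hg.toLp _, Subtype.mem _, (lintegral_congr_ae ?_).trans_le hR⟩
  filter_upwards [AEEqFun.coeFn_sub f (hg.toLp _), hg.coeFn_toLp] with t hsub ht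
  rw [hsub, Pi.sub_apply, ht]

theorem mem_orliczHeart_iff (hΦ : IsOrliczFunction Φ) {f : L0} :
    f ∈ orliczHeart Φ ↔ orliczNorm Φ f < ∞ ∧ ∀ ε : ℝ≥0∞, 0 < ε →
      ∃ g : L0, g ∈ Lp ℝ ∞ (volume : Measure I) ∧ orliczNorm Φ (f - g) ≤ ε := by
  refine ⟨fun hf => ⟨hΦ.orliczNorm_lt_top_of_mem_orliczHeart hf, fun ε hε => ?_⟩,
    fun hf => hΦ.mem_orliczHeart_of_forall_exists_sub fun c hc => ?_⟩
  · obtain ⟨c, -, hcε⟩ := ENNReal.lt_iff_exists_real_btwn.1 hε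
    have hc0 : 0 < c := ENNReal.ofReal_pos.1 hcε.1
    obtain ⟨g, hg, hfg⟩ := hΦ.exists_mem_Lp_modular_sub_le hf hc0
    exact ⟨g, hg, (orliczNorm_le_of_modular_le hc0 hfg).trans hcε.2.le⟩
  · obtain ⟨g, hg, hfg⟩ := hf.2 (ENNReal.ofReal (c / 2)) (ENNReal.ofReal_pos.2 (by positivity))
    obtain ⟨d, hd0, hdc, hd⟩ := exists_modular_le_of_orliczNorm_lt
      (hfg.trans_lt ((ENNReal.ofReal_lt_ofReal_iff hc).2 (half_lt_self hc)))
    exact ⟨g, hg, (hΦ.modular_anti _ hd0 hdc.le).trans hd⟩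

theorem bddAbove_range_of_tsum_ne_top (hΦ : IsOrliczFunction Φ) {y : ℕ → ℝ}
    (h : ∑' k, ENNReal.ofReal (Φ (y k)) ≠ ∞) : BddAbove (range y) := by
  refine ⟨1 + (∑' k, ENNReal.ofReal (Φ (y k))).toReal / Φ 1, ?_⟩
  rintro _ ⟨k, rfl⟩
  have hk := ENNReal.toReal_mono h (ENNReal.le_tsum k)
  rw [ENNReal.toReal_ofReal (hΦ.nonneg _)] at hk
  exact (hΦ.le_one_add_div _).trans
    (by gcongr; exact hΦ.nonneg 1)

theorem map_iSup_div_le_tsum (hΦ : IsOrliczFunction Φ) {y : ℕ → ℝ} (hy : BddAbove (range y))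
    (x : ℝ) :
    ENNReal.ofReal (Φ ((⨆ k, y k) / x)) ≤ ∑' k, ENNReal.ofReal (Φ (y k / x)) := by
  have hclosed : IsClosed {z | ENNReal.ofReal (Φ (z / x)) ≤ ∑' k, ENNReal.ofReal (Φ (y k / x))} :=
    isClosed_le (ENNReal.continuous_ofReal.comp (hΦ.continuous.comp (by fun_prop)))
      continuous_const
  refine closure_minimal ?_ hclosed (csSup_mem_closure (range_nonempty y) hy)
  rintro _ ⟨k, rfl⟩
  exact ENNReal.le_tsum (f := fun k => ENNReal.ofReal (Φ (y k / x))) k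

theorem exists_mem_orliczHeart_forall_le (hΦ : IsOrliczFunction Φ) {g : ℕ → L0} {d : ℕ → ℝ}
    (hd : ∀ k, 0 < d k) (h : ∀ x, 0 < x → ∑' k, modular Φ (d k * x) (g k) ≠ ∞) :
    ∃ G ∈ orliczHeart Φ, ∀ k, ∀ᵐ t : I, |g k t| ≤ |d k * G t| := by
  have hterm (x : ℝ) (k : ℕ) : Measurable fun t : I => ENNReal.ofReal (Φ (|g k t| / d k / x)) :=
    ENNReal.measurable_ofReal.comp
      (hΦ.continuous.measurable.comp (((g k).measurable.abs.div_const _).div_const _))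
  have hu {x : ℝ} (hx : 0 < x) : ∫⁻ t, ∑' k, ENNReal.ofReal (Φ (|g k t| / d k / x)) ≠ ∞ := by
    rw [lintegral_tsum fun k => (hterm x k).aemeasurable]
    simpa only [modular, div_div] using h x hx
  have hbdd : ∀ᵐ t : I, BddAbove (range fun k => |g k t| / d k) := by
    filter_upwards [ae_lt_top (Measurable.tsum (hterm 1)) (hu one_pos)] with t ht
    simp only [div_one] at ht
    exact hΦ.bddAbove_range_of_tsum_ne_top ht.ne
  have hm : Measurable fun t : I => ⨆ k, |g k t| / d k :=
    Measurable.iSup fun k => (g k).measurable.abs.div_const _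
  have hG := AEEqFun.coeFn_mk _ hm.aestronglyMeasurable (μ := (volume : Measure I))
  have hG0 (t : I) : 0 ≤ ⨆ k, |g k t| / d k :=
    Real.iSup_nonneg fun k => div_nonneg (abs_nonneg _) (hd k).le
  refine ⟨AEEqFun.mk _ hm.aestronglyMeasurable, fun x hx => ?_, fun k => ?_⟩
  · refine (lintegral_mono_ae ?_).trans_lt (hu hx).lt_top
    filter_upwards [hbdd, hG] with t hbt ht
    rw [ht, abs_of_nonneg (hG0 t)]
    exact hΦ.map_iSup_div_le_tsum hbt x
  · filter_upwards [hbdd, hG] with t hbt ht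
    rw [ht, abs_mul, abs_of_pos (hd k), abs_of_nonneg (hG0 t), ← div_le_iff₀' (hd k)]
    exact le_ciSup hbt k

theorem tsum_modular_two_pow_mul_ne_top (hΦ : IsOrliczFunction Φ) {g : ℕ → L0}
    (hg : ∀ k, g k ∈ orliczHeart Φ) {c : ℕ → ℝ} (hc : ∀ k, 0 < c k)
    (h1 : ∀ k, modular Φ (c k) (g k) ≤ 1) {x : ℝ} (hx : 0 < x) :
    ∑' k, modular Φ (2 ^ k * c k * x) (g k) ≠ ∞ := by
  have hfin (k : ℕ) : modular Φ (2 ^ k * c k * x) (g k) ≠ ∞ :=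
    (hg k _ (mul_pos (mul_pos (by positivity) (hc k)) hx)).ne
  have hsum : Summable fun k => (modular Φ (2 ^ k * c k * x) (g k)).toReal := by
    refine (summable_geometric_two.mul_left x⁻¹).of_norm_bounded_eventually_nat ?_
    filter_upwards [(tendsto_pow_atTop_atTop_of_one_lt (one_lt_two (α := ℝ))).eventually_ge_atTop
      x⁻¹] with k hk
    rw [Real.norm_of_nonneg ENNReal.toReal_nonneg]
    refine ENNReal.toReal_le_of_le_ofReal (by positivity) ?_
    calc modular Φ (2 ^ k * c k * x) (g k) = modular Φ (x * 2 ^ k * c k) (g k) := by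
          rw [mul_comm, mul_assoc]
      _ ≤ ENNReal.ofReal (x * 2 ^ k)⁻¹ * modular Φ (c k) (g k) :=
          hΦ.modular_mul_le _ ((inv_le_iff_one_le_mul₀' hx).1 hk)
      _ ≤ ENNReal.ofReal (x * 2 ^ k)⁻¹ := mul_le_of_le_one_right' (h1 k)
      _ = ENNReal.ofReal (x⁻¹ * (1 / 2) ^ k) := by rw [mul_inv, one_div, inv_pow]
  simpa only [ENNReal.ofReal_toReal (hfin _)] using hsum.tsum_ofReal_ne_top

end IsOrliczFunction

theorem isOrliczFunction_M2 : IsOrliczFunction M2 where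
  convexOn := by
    have hexp : ConvexOn ℝ univ fun x : ℝ => Real.exp (x ^ 2) :=
      ⟨convex_univ, fun x _ y _ a b ha hb hab =>
        (Real.exp_le_exp.2 (even_two.convexOn_pow.2 (mem_univ x) (mem_univ y) ha hb hab)).trans
          (convexOn_exp.2 (mem_univ _) (mem_univ _) ha hb hab)⟩
    exact hexp.add_const (-1)
  map_zero := by simp [M2]
  pos x hx := by
    have := Real.one_lt_exp_iff.2 (show 0 < x ^ 2 by positivity)
    exact sub_pos.2 this

theorem spaceG_eq_orliczHeart : spaceG = orliczHeart M2 :=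
  Set.ext fun _ => isOrliczFunction_M2.mem_orliczHeart_iff.symm

/-! ### Lattice gauges -/

/-- The class in `L0` of the characteristic function of `A`. -/
def charFn (A : Set I) (hA : MeasurableSet A) : L0 :=
  indicatorConstLp ∞ hA (measure_ne_top volume A) (1 : ℝ)

theorem coeFn_charFn {A : Set I} (hA : MeasurableSet A) :
    charFn A hA =ᵐ[volume] A.indicator fun _ => 1 :=
  indicatorConstLp_coeFn

theorem distribution_charFn {A : Set I} (hA : MeasurableSet A) {s : ℝ} (hs : 0 < s) :
    distribution (charFn A hA) s = if s < 1 then volume A else 0 := by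
  have hind : distribution (charFn A hA) s = volume {t | s < |A.indicator (fun _ => (1 : ℝ)) t|} :=
    measure_congr ((coeFn_charFn hA).mono fun t ht => congrArg (fun x => s < |x|) ht)
  have hset : {t | s < |A.indicator (fun _ => (1 : ℝ)) t|} = if s < 1 then A else ∅ := by
    ext t
    by_cases ht : t ∈ A <;> by_cases hs1 : s < 1 <;> simp [ht, hs1, hs.le]
  rw [hind, hset, apply_ite volume, measure_empty]

/-- A homogeneous, definite and monotone functional on the measurable functions, with values in
`[0,∞]`. This covers the extended norms of Banach function spaces, and equally those of incomplete
and of quasi-normed function spaces, such as `L^p` for `p < 1`. -/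
structure IsLatticeGauge (ρ : L0 → ℝ≥0∞) : Prop where
  map_smul : ∀ (c : ℝ) (f : L0), ρ (c • f) = ENNReal.ofReal |c| * ρ f
  eq_zero_of_map_eq_zero : ∀ f : L0, ρ f = 0 → f = 0
  mono : ∀ f g : L0, (∀ᵐ t, |f t| ≤ |g t|) → ρ f ≤ ρ g

/-- Rearrangement invariance of a functional that is defined on all measurable functions. -/
def IsEquimeasurableInvariant (ρ : L0 → ℝ≥0∞) : Prop :=
  ∀ f g : L0, (∀ s : ℝ, 0 < s → distribution f s = distribution g s) → ρ f = ρ g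

theorem BanachFunctionSpace.isLatticeGauge_extNorm (X : BanachFunctionSpace) :
    IsLatticeGauge X.extNorm :=
  ⟨X.extNorm_smul, X.eq_zero_of_extNorm_eq_zero, X.extNorm_mono⟩

theorem BanachFunctionSpace.IsRearrangementInvariant.isEquimeasurableInvariant_extNorm
    {X : BanachFunctionSpace} (hri : X.IsRearrangementInvariant) :
    IsEquimeasurableInvariant X.extNorm := by
  intro f g h
  by_cases hf : f ∈ X.carrier
  · exact (hri f g h hf).2.symm
  by_cases hg : g ∈ X.carrier
  · exact (hri g f (fun s hs => (h s hs).symm) hg).2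
  exact (not_lt_top_iff.1 hf).trans (not_lt_top_iff.1 hg).symm

/-- The fundamental function `φ_ρ(x) = ρ(χ_{[0,x]})`. -/
def fundamentalFunction (ρ : L0 → ℝ≥0∞) (x : I) : ℝ≥0∞ :=
  ρ (charFn (Iic x) measurableSet_Iic)

theorem IsEquimeasurableInvariant.map_charFn {ρ : L0 → ℝ≥0∞} (hri : IsEquimeasurableInvariant ρ)
    {A : Set I} (hA : MeasurableSet A) {x : I} (hx : volume A = ENNReal.ofReal x) :
    ρ (charFn A hA) = fundamentalFunction ρ x :=
  hri _ _ fun s hs => by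
    rw [distribution_charFn hA hs, distribution_charFn measurableSet_Iic hs,
      unitInterval.volume_Iic, hx]

namespace IsLatticeGauge

variable {ρ : L0 → ℝ≥0∞}

theorem map_charFn_mono (hρ : IsLatticeGauge ρ) {A B : Set I} (hA : MeasurableSet A)
    (hB : MeasurableSet B) (hAB : A ⊆ B) : ρ (charFn A hA) ≤ ρ (charFn B hB) := by
  refine hρ.mono _ _ ?_
  filter_upwards [coeFn_charFn hA, coeFn_charFn hB] with t htA htB
  rw [htA, htB, abs_of_nonneg (indicator_nonneg (fun _ _ => zero_le_one) t),
    abs_of_nonneg (indicator_nonneg (fun _ _ => zero_le_one) t)]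
  exact indicator_le_indicator_of_subset hAB (fun _ => zero_le_one) t

theorem fundamentalFunction_mono (hρ : IsLatticeGauge ρ) : Monotone (fundamentalFunction ρ) :=
  fun _ _ hxy => hρ.map_charFn_mono _ _ (Iic_subset_Iic.2 hxy)

theorem fundamentalFunction_ne_zero (hρ : IsLatticeGauge ρ) {x : I} (hx : 0 < x) :
    fundamentalFunction ρ x ≠ 0 := by
  intro h
  have hzero : distribution (0 : L0) (1 / 2) = 0 := by
    rw [distribution, measure_eq_zero_iff_ae_notMem]
    filter_upwards [AEEqFun.coeFn_zero (α := I) (β := ℝ) (μ := volume)] with t ht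
    simp only [ht]
    norm_num
  rw [← hρ.eq_zero_of_map_eq_zero _ h, distribution_charFn _ one_half_pos,
    if_pos one_half_lt_one, unitInterval.volume_Iic, ENNReal.ofReal_eq_zero] at hzero
  exact hzero.not_gt hx

theorem mul_fundamentalFunction_le (hρ : IsLatticeGauge ρ) (hri : IsEquimeasurableInvariant ρ)
    {g : L0} {s : ℝ} (hs : 0 ≤ s) {x : I} (hx : ENNReal.ofReal x ≤ distribution g s) :
    ENNReal.ofReal s * fundamentalFunction ρ x ≤ ρ g := by
  set A := {t : I | s < |g t|}
  have hA : MeasurableSet A := measurableSet_lt measurable_const g.measurable.abs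
  set y : I := ⟨volume.real A, measureReal_nonneg, measureReal_le_one⟩
  have hy : volume A = ENNReal.ofReal y := (ofReal_measureReal).symm
  have hxy : x ≤ y := (ENNReal.ofReal_le_ofReal_iff y.2.1).1 (hx.trans_eq hy)
  calc ENNReal.ofReal s * fundamentalFunction ρ x
      ≤ ENNReal.ofReal s * fundamentalFunction ρ y := by
        gcongr
        exact hρ.fundamentalFunction_mono hxy
    _ = ρ (s • charFn A hA) := by
        rw [hρ.map_smul, abs_of_nonneg hs, hri.map_charFn hA hy]
    _ ≤ ρ g := by
        refine hρ.mono _ _ ?_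
        filter_upwards [AEEqFun.coeFn_smul s (charFn A hA), coeFn_charFn hA] with t hsmul ht
        rw [hsmul, Pi.smul_apply, ht, smul_eq_mul]
        by_cases htA : t ∈ A
        · simpa [htA, abs_of_nonneg hs] using htA.le
        · simp [htA]

-- If `ρ` were unbounded on `g_k`, say `‖g_k‖_Φ ≤ c_k` and `ρ(g_k) > 4ᵏ c_k`, then
-- `sup_k |g_k| / (2ᵏ c_k)` would be a function of the heart with `ρ = ∞`.
theorem exists_le_mul_orliczNorm (hρ : IsLatticeGauge ρ) {Φ : ℝ → ℝ}
    (hΦ : IsOrliczFunction Φ) (hfin : ∀ g ∈ orliczHeart Φ, ρ g < ∞) :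
    ∃ K : ℝ, 0 < K ∧ ∀ g ∈ orliczHeart Φ, ρ g ≤ ENNReal.ofReal K * orliczNorm Φ g := by
  suffices ∃ K : ℝ, 0 < K ∧ ∀ g ∈ orliczHeart Φ, ∀ c, 0 < c → modular Φ c g ≤ 1 →
      ρ g ≤ ENNReal.ofReal (K * c) by
    obtain ⟨K, hK0, hK⟩ := this
    refine ⟨K, hK0, fun g hg => ?_⟩
    rw [mul_comm, ← ENNReal.div_le_iff (ENNReal.ofReal_pos.2 hK0).ne' ENNReal.ofReal_ne_top]
    refine le_iInf₂ fun c hc => ?_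
    rw [ENNReal.div_le_iff (ENNReal.ofReal_pos.2 hK0).ne' ENNReal.ofReal_ne_top, mul_comm,
      ← ENNReal.ofReal_mul hK0.le]
    exact hK g hg c hc.1 hc.2
  by_contra! hcon
  choose g hg c hc h1 hgc using fun k : ℕ => hcon (4 ^ k) (by positivity)
  have hd (k : ℕ) : 0 < 2 ^ k * c k := mul_pos (by positivity) (hc k)
  obtain ⟨G, hG, hgG⟩ := hΦ.exists_mem_orliczHeart_forall_le hd
    fun x hx => hΦ.tsum_modular_two_pow_mul_ne_top hg hc h1 hx
  obtain ⟨k, hk⟩ := pow_unbounded_of_one_lt (ρ G).toReal (one_lt_two (α := ℝ))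
  have hle : ρ (g k) ≤ ENNReal.ofReal (4 ^ k * c k) :=
    calc ρ (g k) ≤ ρ ((2 ^ k * c k) • G) := by
          refine hρ.mono _ _ ?_
          filter_upwards [hgG k, AEEqFun.coeFn_smul (2 ^ k * c k) G] with t ht hsmul
          rwa [hsmul]
      _ = ENNReal.ofReal (2 ^ k * c k) * ρ G := by rw [hρ.map_smul, abs_of_pos (hd k)]
      _ ≤ ENNReal.ofReal (2 ^ k * c k) * ENNReal.ofReal (2 ^ k) := by
          gcongr
          exact (ENNReal.le_ofReal_iff_toReal_le (hfin _ hG).ne (by positivity)).2 hk.le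
      _ = ENNReal.ofReal (4 ^ k * c k) := by
          rw [← ENNReal.ofReal_mul (hd k).le, show (4 : ℝ) = 2 * 2 by norm_num, mul_pow]
          ring_nf
  exact (hgc k).not_ge hle

end IsLatticeGauge

/-! ### Walsh series in the local space -/

/-- The function `f ∘ ρ_E⁻¹` on `[0,1]`, so that `‖f|_E‖_{X|E} = ‖pullRho E hE f‖_X`. -/
def pullRho (E : Set I) (hE : 0 < volume E) (f : L0) : L0 :=
  (restrictTo E f).compQuasiMeasurePreserving (rhoInv E) (quasiMeasurePreserving_rhoInv hE)

section PullRho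

variable {E : Set I} (hE : 0 < volume E)

include hE in
theorem measurePreserving_rhoInv : MeasurePreserving (rhoInv E) volume volume[|E] :=
  ⟨measurable_rhoInv hE, map_rhoInv hE⟩

theorem coeFn_pullRho (f : L0) : pullRho E hE f =ᵐ[volume] fun t => f (rhoInv E t) := by
  filter_upwards [AEEqFun.coeFn_compQuasiMeasurePreserving (restrictTo E f)
      (quasiMeasurePreserving_rhoInv hE),
    (quasiMeasurePreserving_rhoInv hE).ae
      (AEEqFun.coeFn_mk f f.aestronglyMeasurable.restrict)] with t hcomp hrestrict
  exact hcomp.trans hrestrict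

include hE in
theorem ae_rhoInv {p : I → Prop} (h : ∀ᵐ t, p t) : ∀ᵐ t, p (rhoInv E t) :=
  (quasiMeasurePreserving_rhoInv hE).ae (ae_restrict_of_ae h)

theorem pullRho_sub (f g : L0) : pullRho E hE (f - g) = pullRho E hE f - pullRho E hE g := by
  refine AEEqFun.ext ?_
  filter_upwards [coeFn_pullRho hE (f - g), coeFn_pullRho hE f, coeFn_pullRho hE g,
    AEEqFun.coeFn_sub (pullRho E hE f) (pullRho E hE g),
    ae_rhoInv hE (AEEqFun.coeFn_sub f g)] with t hfg hf hg hpull hsub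
  rw [hfg, hpull, Pi.sub_apply, hf, hg, hsub, Pi.sub_apply]

theorem pullRho_mem_Lp_top {f : L0} {R : ℝ} (hf : ∀ᵐ t, |f t| ≤ R) :
    pullRho E hE f ∈ Lp ℝ ∞ (volume : Measure I) := by
  refine Lp.mem_Lp_iff_memLp.2 (memLp_top_of_bound (pullRho E hE f).aestronglyMeasurable R ?_)
  filter_upwards [coeFn_pullRho hE f, ae_rhoInv hE hf] with t ht hR
  rwa [ht]

theorem distribution_pullRho (f : L0) (s : ℝ) :
    distribution (pullRho E hE f) s = volume[|E] {t | s < |f t|} := by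
  rw [← (measurePreserving_rhoInv hE).measure_preimage
    (measurableSet_lt measurable_const f.measurable.abs).nullMeasurableSet]
  refine measure_congr ((coeFn_pullRho hE f).mono fun t ht => ?_)
  exact congrArg (fun x => s < |x|) ht

theorem modular_pullRho {Φ : ℝ → ℝ} (hΦ : IsOrliczFunction Φ) (c : ℝ) (f : L0) :
    modular Φ c (pullRho E hE f) = ∫⁻ t, ENNReal.ofReal (Φ (|f t| / c)) ∂volume[|E] := by
  have hm : Measurable fun t => ENNReal.ofReal (Φ (|f t| / c)) :=
    ENNReal.measurable_ofReal.comp (hΦ.continuous.measurable.comp (f.measurable.abs.div_const c))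
  rw [← (measurePreserving_rhoInv hE).lintegral_comp hm]
  refine lintegral_congr_ae ((coeFn_pullRho hE f).mono fun t ht => ?_)
  simp only [ht]

end PullRho

namespace IsRademacherLikeOn

variable {L : ℕ} {E : Set I} {n : ℕ → ℕ} {a : ℕ → ℝ} {f : Lp ℝ 2 (volume : Measure I)}

theorem modular_M2_pullRho_le (h : IsRademacherLikeOn L E n) (hE : 0 < volume E)
    (ha : Summable fun k => a k ^ 2) (hf : HasSum (fun k => a k • walshL2 (n k)) f) {c : ℝ}
    (hc : 0 < c) (hac : 8 * (L * ∑' k, a k ^ 2) ≤ c ^ 2) :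
    modular M2 c (pullRho E hE f) ≤ 1 := by
  have := cond_isProbabilityMeasure hE.ne'
  have hexp := h.lintegral_exp_le ha hf (s := (c ^ 2)⁻¹) (by positivity)
    (mul_inv_le_one_of_le₀ hac (by positivity))
  have hM2 (t : I) : ENNReal.ofReal (Real.exp ((c ^ 2)⁻¹ * f t ^ 2)) =
      ENNReal.ofReal (M2 (|f t| / c)) + 1 := by
    rw [← ENNReal.ofReal_one, ← ENNReal.ofReal_add (isOrliczFunction_M2.nonneg _) zero_le_one,
      M2, sub_add_cancel, div_pow, sq_abs, inv_mul_eq_div]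
  simp only [hM2] at hexp
  rw [lintegral_add_right _ measurable_const, lintegral_one, measure_univ] at hexp
  rw [modular_pullRho hE isOrliczFunction_M2]
  exact (ENNReal.add_le_add_iff_right ENNReal.one_ne_top).1
    (hexp.trans_eq one_add_one_eq_two.symm)

theorem pullRho_mem_orliczHeart_M2 (h : IsRademacherLikeOn L E n) (hE : 0 < volume E)
    (ha : Summable fun k => a k ^ 2) (hf : HasSum (fun k => a k • walshL2 (n k)) f) :
    pullRho E hE f ∈ orliczHeart M2 := by
  refine isOrliczFunction_M2.mem_orliczHeart_of_forall_exists_sub fun c hc => ?_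
  have htail : Tendsto (fun K => 8 * (L * ∑' k, a (k + K) ^ 2)) atTop (𝓝 (8 * (L * 0))) :=
    ((tendsto_sum_nat_add fun k => a k ^ 2).const_mul _).const_mul _
  obtain ⟨K, hK⟩ := (htail.eventually_le_const (show 8 * (L * 0) < c ^ 2 by
    rw [mul_zero, mul_zero]; positivity)).exists
  refine ⟨pullRho E hE ((∑ k ∈ Finset.range K, a k • walshL2 (n k) : Lp ℝ 2 volume) : L0),
    pullRho_mem_Lp_top hE (R := ∑ k ∈ Finset.range K, |a k|) ?_, ?_⟩
  · filter_upwards [coeFn_sum_walshL2 a n (Finset.range K)] with t ht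
    exact (congrArg abs ht).trans_le (abs_walshSum_le a n (Finset.range K) t)
  · rw [← pullRho_sub, ← AddSubgroupClass.coe_sub]
    exact (h.shift K).modular_M2_pullRho_le hE ((summable_nat_add_iff K).2 ha)
      ((hasSum_nat_add_iff' K).2 hf) hc hK

theorem orliczNorm_M2_pullRho_le (h : IsRademacherLikeOn L E n) (hE : 0 < volume E)
    (ha : Summable fun k => a k ^ 2) (hf : HasSum (fun k => a k • walshL2 (n k)) f) :
    orliczNorm M2 (pullRho E hE f) ≤ ENNReal.ofReal √(8 * (L * ∑' k, a k ^ 2)) := by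
  refine le_of_forall_gt fun b hb => ?_
  obtain ⟨c, -, hsc, hcb⟩ := ENNReal.lt_iff_exists_real_btwn.1 hb
  have hlt : √(8 * (L * ∑' k, a k ^ 2)) < c :=
    (ENNReal.ofReal_lt_ofReal_iff_of_nonneg (Real.sqrt_nonneg _)).1 hsc
  have hc : 0 < c := (Real.sqrt_nonneg _).trans_lt hlt
  exact (orliczNorm_le_of_modular_le hc
    (h.modular_M2_pullRho_le hE ha hf hc ((Real.sqrt_lt' hc).1 hlt).le)).trans_lt hcb

theorem mul_fundamentalFunction_le_map_pullRho (h : IsRademacherLikeOn L E n)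
    (hE : 0 < volume E) (hL : 0 < L) (ha : Summable fun k => a k ^ 2)
    (hf : HasSum (fun k => a k • walshL2 (n k)) f) {ρ : L0 → ℝ≥0∞}
    (hρ : IsLatticeGauge ρ) (hri : IsEquimeasurableInvariant ρ) {x : I}
    (hx : (x : ℝ) ≤ 1 / (2048 * (L : ℝ) ^ 2)) :
    ENNReal.ofReal (√(∑' k, a k ^ 2) / 2) * fundamentalFunction ρ x ≤ ρ (pullRho E hE f) := by
  have hv0 : 0 ≤ ∑' k, a k ^ 2 := tsum_nonneg fun k => sq_nonneg (a k)
  rcases hv0.eq_or_lt with hv | hv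
  · simp [← hv]
  refine hρ.mul_fundamentalFunction_le hri (by positivity) ?_
  have hset : {t | √(∑' k, a k ^ 2) / 2 < |f t|} = {t | (∑' k, a k ^ 2) / 4 < f t ^ 2} := by
    ext t
    rw [mem_ofPred_eq, mem_ofPred_eq, ← sq_lt_sq₀ (by positivity) (abs_nonneg _), sq_abs,
      div_pow, Real.sq_sqrt hv.le]
    norm_num
  rw [distribution_pullRho, hset]
  exact ENNReal.ofReal_le_of_le_toReal (hx.trans (h.le_measureReal_lt_sq hE.ne' hL ha hf hv))

end IsRademacherLikeOn

theorem exists_ofReal_mul_sqrt_le_map_pullRho {ρ : L0 → ℝ≥0∞} (hρ : IsLatticeGauge ρ)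
    (hri : IsEquimeasurableInvariant ρ) {L : ℕ} (hL : 0 < L) :
    ∃ A : ℝ, 0 < A ∧ ∀ (E : Set I) (hE : 0 < volume E) (n : ℕ → ℕ), IsRademacherLikeOn L E n →
      ∀ a : ℕ → ℝ, Summable (fun k => a k ^ 2) →
        ∀ f : Lp ℝ 2 (volume : Measure I), HasSum (fun k => a k • walshL2 (n k)) f →
          ENNReal.ofReal (A * √(∑' k, a k ^ 2)) ≤ ρ (pullRho E hE f) := by
  have hL1 : (1 : ℝ) ≤ 2048 * L ^ 2 := by
    have : (1 : ℝ) ≤ L := by exact_mod_cast hL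
    nlinarith
  let x : I := ⟨1 / (2048 * (L : ℝ) ^ 2), by positivity, div_le_one_of_le₀ hL1 (by positivity)⟩
  have hx : 0 < x := show (0 : ℝ) < 1 / (2048 * (L : ℝ) ^ 2) by positivity
  obtain ⟨A, -, hA0, hA⟩ := ENNReal.lt_iff_exists_real_btwn.1
    (hρ.fundamentalFunction_ne_zero hx).bot_lt
  refine ⟨A / 2, half_pos (ENNReal.ofReal_pos.1 hA0), fun E hE n h a ha f hf => ?_⟩
  calc ENNReal.ofReal (A / 2 * √(∑' k, a k ^ 2))
      = ENNReal.ofReal (√(∑' k, a k ^ 2) / 2) * ENNReal.ofReal A := by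
        rw [← ENNReal.ofReal_mul (by positivity), div_mul_comm]
    _ ≤ ENNReal.ofReal (√(∑' k, a k ^ 2) / 2) * fundamentalFunction ρ x := by gcongr
    _ ≤ ρ (pullRho E hE f) :=
        h.mul_fundamentalFunction_le_map_pullRho hE hL ha hf hρ hri le_rfl

theorem exists_map_pullRho_le_ofReal_mul_sqrt {ρ : L0 → ℝ≥0∞} (hρ : IsLatticeGauge ρ)
    (hG : ∀ g ∈ spaceG, ρ g < ∞) {L : ℕ} (hL : 0 < L) :
    ∃ B : ℝ, 0 < B ∧ ∀ (E : Set I) (hE : 0 < volume E) (n : ℕ → ℕ), IsRademacherLikeOn L E n →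
      ∀ a : ℕ → ℝ, Summable (fun k => a k ^ 2) →
        ∀ f : Lp ℝ 2 (volume : Measure I), HasSum (fun k => a k • walshL2 (n k)) f →
          ρ (pullRho E hE f) ≤ ENNReal.ofReal (B * √(∑' k, a k ^ 2)) := by
  rw [spaceG_eq_orliczHeart] at hG
  obtain ⟨K, hK0, hK⟩ := hρ.exists_le_mul_orliczNorm isOrliczFunction_M2 hG
  refine ⟨K * √(8 * L), by positivity, fun E hE n h a ha f hf => ?_⟩
  calc ρ (pullRho E hE f)
      ≤ ENNReal.ofReal K * orliczNorm M2 (pullRho E hE f) :=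
        hK _ (h.pullRho_mem_orliczHeart_M2 hE ha hf)
    _ ≤ ENNReal.ofReal K * ENNReal.ofReal √(8 * (L * ∑' k, a k ^ 2)) := by
        gcongr
        exact h.orliczNorm_M2_pullRho_le hE ha hf
    _ = ENNReal.ofReal (K * √(8 * L) * √(∑' k, a k ^ 2)) := by
        rw [← ENNReal.ofReal_mul hK0.le, ← mul_assoc 8, Real.sqrt_mul (by positivity), mul_assoc]

end LacunaryWalsh

end

open LacunaryWalsh in
theorem corollary3p3_general (q : ℝ) (hq : 1 < q) :
    ∃ N : Set I → ℕ, ∀ ρ : L0 → ℝ≥0∞, IsLatticeGauge ρ → IsEquimeasurableInvariant ρ →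
      (∀ g ∈ spaceG, ρ g < ∞) →
      ∃ A B : ℝ, 0 < A ∧ 0 < B ∧
        ∀ (E : Set I) (_ : NullMeasurableSet E volume) (hE : 0 < volume E) (n : ℕ → ℕ),
          IsLacunary q n → (∀ k, N E ≤ n k) →
          ∀ a : ℕ → ℝ, Summable (fun k => a k ^ 2) →
            ∃ f : Lp ℝ 2 (volume : Measure I), HasSum (fun k => a k • walshL2 (n k)) f ∧
              ENNReal.ofReal (A * √(∑' k, a k ^ 2)) ≤ ρ (pullRho E hE f) ∧
              ρ (pullRho E hE f) ≤ ENNReal.ofReal (B * √(∑' k, a k ^ 2)) := by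
  obtain ⟨L, hL, hRad⟩ := exists_isRademacherLikeOn_of_isLacunary hq
  choose! N hN using hRad
  refine ⟨N, fun ρ hρ hri hG => ?_⟩
  obtain ⟨A, hA0, hA⟩ := exists_ofReal_mul_sqrt_le_map_pullRho hρ hri hL
  obtain ⟨B, hB0, hB⟩ := exists_map_pullRho_le_ofReal_mul_sqrt hρ hG hL
  refine ⟨A, B, hA0, hB0, fun E hEm hE n hn hNn a ha => ?_⟩
  have hE' : IsRademacherLikeOn L E n := hN E hEm hE n hn hNn
  obtain ⟨f, hf⟩ := summable_smul_walshL2 (hn.strictMono hq).injective ha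
  exact ⟨f, hf, hA E hE n hE' a ha f hf, hB E hE n hE' a ha f hf⟩

theorem corollary3p3 (q : ℝ) (hq : 1 < q) :
    ∃ N : Set I → ℕ, ∀ X : LacunaryWalsh.BanachFunctionSpace, X.IsRearrangementInvariant →
      LacunaryWalsh.spaceG ⊆ X.carrier →
      ∃ A B : ℝ, 0 < A ∧ 0 < B ∧
        ∀ (E : Set I) (_ : NullMeasurableSet E volume) (hE : 0 < volume E) (n : ℕ → ℕ),
          LacunaryWalsh.IsLacunary q n → (∀ k, N E ≤ n k) →
          ∀ a : ℕ → ℝ, Summable (fun k => a k ^ 2) →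
            ∃ f : Lp ℝ 2 (volume : Measure I),
              HasSum (fun k => a k • LacunaryWalsh.walshL2 (n k)) f ∧
              ENNReal.ofReal (A * Real.sqrt (∑' k, a k ^ 2)) ≤
                X.localNorm E hE (LacunaryWalsh.restrictTo E f) ∧
              X.localNorm E hE (LacunaryWalsh.restrictTo E f) ≤
                ENNReal.ofReal (B * Real.sqrt (∑' k, a k ^ 2)) := by
  obtain ⟨N, hN⟩ := corollary3p3_general q hq
  exact ⟨N, fun X hri hX => hN X.extNorm X.isLatticeGauge_extNorm
    hri.isEquimeasurableInvariant_extNorm hX⟩
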